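/- Let $k\ge 1$, let ${\bf n}=(n_1,\dots,n_k)$ and ${\bf m}=(m_1,\dots,m_k)$ be tuples of positive integers, and let ${\bf f}=(f_1,\dots,f_k)$, where $f_i=\sum_{\alpha\in\mathbb F_{n_i}^+}a_{i,\alpha}Z_\alpha$ is a positive regular free holomorphic function in $n_i$ noncommuting indeterminates; that is, with $\mathbb F_{n}^+$ the free monoid on $g_1,\dots,g_{n}$ and $|\alpha|$ the length of a word $\alpha$, we have $a_{i,\alpha}\ge 0$, $a_{i,1}=0$ for the empty word $1$, $a_{i,g_j}>0$ for $1\le j\le n_i$, and $\limsup_{l\to\infty}\big(\sum_{|\alpha|=l}|a_{i,\alpha}|^2\big)^{1/2l}<\infty$. For a word $\alpha\in\mathbb F_{n_i}^+$ put $b_{i,1}=1$ and, for $|\alpha|\ge1$, $$b_{i,\alpha}=\sum_{p=1}^{|\alpha|}\ \sum_{\gamma_1\cdots\gamma_p=\alpha,\ |\gamma_1|,\dots,|\gamma_p|\ge1}a_{i,\gamma_1}\cdots a_{i,\gamma_p}\binom{p+m_i-1}{m_i-1}.$$ Let $F^2(H_{n_i})$ be the full Fock space, with orthonormal basis $(e_\alpha)_{\alpha\in\mathbb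 F_{n_i}^+}$, let $W_{i,j}$ be the bounded operator on it with $W_{i,j}e_\alpha=\sqrt{b_{i,\alpha}/b_{i,g_j\alpha}}\;e_{g_j\alpha}$, and let ${\bf W}_{i,j}=I\otimes\cdots\otimes W_{i,j}\otimes\cdots\otimes I$ (with $W_{i,j}$ at the $i$-th place) on $\bigotimes_{i=1}^kF^2(H_{n_i})$. Write $\mathcal F_{\mathcal H}=(\bigotimes_{i=1}^kF^2(H_{n_i}))\otimes\mathcal H$ (Hilbert tensor product) for a complex Hilbert space $\mathcal H$. For a tuple $X=(X_1,\dots,X_n)$ of bounded operators on a Hilbert space and a positive regular $f=\sum_\alpha a_\alpha Z_\alpha$ in $n$ indeterminates, put $$\Phi_{f,X}(Y)=\sum_{l=1}^\infty\sum_{|\alpha|=l}a_\alpha X_\alpha YX_\alpha^*\quad\text{(weak operator topology)},\qquad X_\alpha=X_{j_1}\cdots X_{j_l}\ \text{ for }\ \alpha=g_{j_1}\cdots g_{j_l}.$$ A bounded operator $M:\mathcal F_{\mathcal E}\to\mathcal F_{\mathcal H}$ is called multi-analytic with respect to ${\bf W}$ if $M({\bf W}_{i,j}\otimes I_{\mathcal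 E})=({\bf W}_{i,j}\otimes I_{\mathcal H})M$ for all $i,j$, and inner multi-analytic if it is moreover a partial isometry. Let $\mathcal H$ be a complex Hilbert space and let ${\bf W}_i\otimes I_{\mathcal H}=({\bf W}_{i,1}\otimes I_{\mathcal H},\dots,{\bf W}_{i,n_i}\otimes I_{\mathcal H})$. Then for each $i$ the series defining $\Phi_{f_i,{\bf W}_i\otimes I_{\mathcal H}}(Y)$ converges in the weak operator topology for every $Y\in B(\mathcal F_{\mathcal H})$. For ${\bf p}\in\mathbb Z_+^k$ put $${\bf\Delta}^{\bf p}(Y)=(id-\Phi_{f_1,{\bf W}_1\otimes I_{\mathcal H}})^{p_1}\cdots(id-\Phi_{f_k,{\bf W}_k\otimes I_{\mathcal H}})^{p_k}(Y).$$ (a) For every $Y\in B(\mathcal F_{\mathcal H})$ the following are equivalent: (i) there are a Hilbert space $\mathcal E$ and a multi-analytic operator $M:\mathcal F_{\mathcal E}\to\mathcal F_{\mathcal H}$ with $Y=MM^*$; (ii) ${\bf\Delta}^{\bf p}(Y)\ge0$ for all ${\bf p}\in\mathbb Z_+^k$ with ${\bf p}\le{\bf m}$ (coordinatewise) and ${\bf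 p}\ne0$. (b) Let $\mathcal M\subset\mathcal F_{\mathcal H}$ be a closed subspace that is invariant under all ${\bf W}_{i,j}\otimes I_{\mathcal H}$, and let $P_{\mathcal M}$ be the orthogonal projection onto it. Then $\mathcal M$ is of Beurling type, i.e. $\mathcal M=\Psi(\mathcal F_{\mathcal E})$ for some Hilbert space $\mathcal E$ and some inner multi-analytic operator $\Psi:\mathcal F_{\mathcal E}\to\mathcal F_{\mathcal H}$, if and only if ${\bf\Delta}^{\bf p}(P_{\mathcal M})\ge0$ for all ${\bf p}\in\mathbb Z_+^k$ with ${\bf p}\le{\bf m}$. (c) Let $\mathcal M$ be as in (b), let ${\bf m}=(1,\dots,1)$, and let the tuple of restrictions $V_{i,j}=({\bf W}_{i,j}\otimes I_{\mathcal H})|_{\mathcal M}\in B(\mathcal M)$ be doubly commuting, i.e. $V_{i,p}V_{j,q}^*=V_{j,q}^*V_{i,p}$ whenever $i\ne j$. Then ${\bf\Delta}^{\bf p}(P_{\mathcal M})\ge0$ for all ${\bf p}\le{\bf m}$, and consequently $\mathcal M$ is of Beurling type. -/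

import Mathlib

open Filter Topology

universe u v

noncomputable section

namespace Polydomain

/-! ### Positive regular free holomorphic functions

Words in `n` letters are elements of `FreeMonoid (Fin n)`; the word `1` is the empty word. -/

/-- A positive regular free holomorphic function `f = ∑ a_α Z_α` in `n` noncommuting
indeterminates: `a_α ≥ 0`, `a_1 = 0`, `a_{g_j} > 0` for every letter, and
`limsup_k (∑_{|α| = k} |a_α|²)^{1/(2k)} < ∞`. -/
structure PositiveRegular (n : ℕ) where
  /-- the coefficient `a_α` of the word `α` -/
  coeff : FreeMonoid (Fin n) → ℝ
  coeff_nonneg : ∀ α, 0 ≤ coeff α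
  coeff_one : coeff 1 = 0
  coeff_of_pos : ∀ j : Fin n, 0 < coeff (FreeMonoid.of j)
  limsup_lt_top :
    limsup (fun k : ℕ =>
      (∑ w : Fin k → Fin n, ENNReal.ofReal (|coeff (FreeMonoid.ofList (List.ofFn w))| ^ 2))
        ^ (1 / (2 * (k : ℝ)))) atTop < ⊤

/-- The coefficients `b_α^{(m)} = ∑_p ∑_{γ₁ ⋯ γ_p = α, |γ_i| ≥ 1} a_{γ₁} ⋯ a_{γ_p} C(p+m-1, m-1)`.
Factorisations of `α` into `p` nonempty words are the compositions of `|α|` of length `p`. The empty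
word has just the empty factorisation, so that `b_1^{(m)} = 1`. -/
def bCoeff {n : ℕ} (a : FreeMonoid (Fin n) → ℝ) (m : ℕ) (α : FreeMonoid (Fin n)) : ℝ :=
  ∑ c : Composition α.length,
    ((α.toList.splitWrtComposition c).map fun γ => a (FreeMonoid.ofList γ)).prod
      * ((c.length + m - 1).choose (m - 1) : ℝ)

theorem bCoeff_one {n : ℕ} (a : FreeMonoid (Fin n) → ℝ) (m : ℕ) : bCoeff a m 1 = 1 := by
  have h : ∀ c : Composition (FreeMonoid.length (1 : FreeMonoid (Fin n))), c.length = 0 := by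
    intro c
    exact Nat.le_zero.1 c.length_le
  have h2 : ∀ c : Composition (FreeMonoid.length (1 : FreeMonoid (Fin n))),
      List.splitWrtComposition (FreeMonoid.toList (1 : FreeMonoid (Fin n))) c = [] := by
    intro c
    apply List.eq_nil_of_length_eq_zero
    rw [List.length_splitWrtComposition, h]
  unfold bCoeff
  simp only [h, h2]
  have h3 : Fintype.card (Composition (FreeMonoid.length (1 : FreeMonoid (Fin n)))) = 1 := by
    rw [composition_card]; rfl
  simp only [List.map_nil, List.prod_nil, Finset.sum_const, Finset.card_univ, h3]
  simp

/-- The composition `(1, c₁, c₂, …)`. -/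
def consOne {N : ℕ} (c : Composition N) : Composition (N + 1) where
  blocks := 1 :: c.blocks
  blocks_pos := by
    intro i hi
    rcases List.mem_cons.1 hi with h | h
    · omega
    · exact c.blocks_pos h
  blocks_sum := by simp [c.blocks_sum, add_comm]

theorem consOne_injective {N : ℕ} : Function.Injective (consOne (N := N)) := by
  intro c d h
  have : (1 :: c.blocks) = 1 :: d.blocks := congrArg Composition.blocks h
  exact Composition.ext (List.cons.inj this).2

theorem bCoeff_term_nonneg {n : ℕ} (f : PositiveRegular n) (m N : ℕ) (l : List (Fin n))
    (c : Composition N) :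
    0 ≤ ((l.splitWrtComposition c).map fun γ => f.coeff (FreeMonoid.ofList γ)).prod
      * ((c.length + m - 1).choose (m - 1) : ℝ) := by
  refine mul_nonneg (List.prod_nonneg ?_) (Nat.cast_nonneg _)
  intro x hx
  obtain ⟨γ, -, rfl⟩ := List.mem_map.1 hx
  exact f.coeff_nonneg _

theorem bCoeff_of_mul {n : ℕ} (f : PositiveRegular n) (m : ℕ) (j : Fin n)
    (α : FreeMonoid (Fin n)) :
    f.coeff (FreeMonoid.of j) * bCoeff f.coeff m α
      ≤ bCoeff f.coeff m (FreeMonoid.of j * α) := by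
  have key : ∀ c : Composition α.length,
      f.coeff (FreeMonoid.of j) *
        (((α.toList.splitWrtComposition c).map fun γ => f.coeff (FreeMonoid.ofList γ)).prod
          * ((c.length + m - 1).choose (m - 1) : ℝ)) ≤
      (((j :: α.toList).splitWrtComposition (consOne c)).map
          fun γ => f.coeff (FreeMonoid.ofList γ)).prod
          * (((consOne c).length + m - 1).choose (m - 1) : ℝ) := by
    intro c
    have e : (j :: α.toList).splitWrtComposition (consOne c)
        = [j] :: α.toList.splitWrtComposition c := by
      simp [List.splitWrtComposition, consOne, List.splitWrtCompositionAux_cons]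
    have hl : (consOne c).length = c.length + 1 := by
      simp [consOne, Composition.length]
    rw [e, hl, List.map_cons, List.prod_cons, FreeMonoid.ofList_singleton, ← mul_assoc]
    refine mul_le_mul_of_nonneg_left ?_ ?_
    · exact_mod_cast Nat.choose_le_choose _ (by omega)
    · refine mul_nonneg (f.coeff_nonneg _) (List.prod_nonneg ?_)
      intro x hx
      obtain ⟨γ, -, rfl⟩ := List.mem_map.1 hx
      exact f.coeff_nonneg _
  unfold bCoeff
  rw [Finset.mul_sum]
  refine (Finset.sum_le_sum fun c _ => key c).trans ?_
  have hm := Finset.sum_map (Finset.univ : Finset (Composition α.length))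
    ⟨consOne, consOne_injective⟩ (fun c : Composition (α.length + 1) =>
      (((j :: α.toList).splitWrtComposition c).map fun γ => f.coeff (FreeMonoid.ofList γ)).prod
          * ((c.length + m - 1).choose (m - 1) : ℝ))
  refine (le_of_eq hm.symm).trans ?_
  exact Finset.sum_le_univ_sum_of_nonneg
    (fun c => bCoeff_term_nonneg f m _ (j :: α.toList) c)

theorem bCoeff_pos {n : ℕ} (f : PositiveRegular n) (m : ℕ) (α : FreeMonoid (Fin n)) :
    0 < bCoeff f.coeff m α := by
  induction α using FreeMonoid.inductionOn' with
  | one => rw [bCoeff_one]; exact one_pos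
  | of_mul j α ih =>
    exact lt_of_lt_of_le (mul_pos (f.coeff_of_pos j) ih) (bCoeff_of_mul f m j α)

/-- The weights `√b_α / √b_{g_j α}` of the weighted left creation operators. -/
def weight {n : ℕ} (f : PositiveRegular n) (m : ℕ) (j : Fin n) (α : FreeMonoid (Fin n)) : ℝ :=
  √(bCoeff f.coeff m α) / √(bCoeff f.coeff m (FreeMonoid.of j * α))

theorem abs_weight_le {n : ℕ} (f : PositiveRegular n) (m : ℕ) (j : Fin n)
    (α : FreeMonoid (Fin n)) :
    |weight f m j α| ≤ 1 / √(f.coeff (FreeMonoid.of j)) := by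
  have hb := bCoeff_pos f m (FreeMonoid.of j * α)
  have ha := f.coeff_of_pos j
  unfold weight
  rw [abs_of_nonneg (by positivity), div_le_div_iff₀ (by positivity) (by positivity), one_mul,
    ← Real.sqrt_mul (bCoeff_pos f m α).le]
  refine Real.sqrt_le_sqrt ?_
  rw [mul_comm]
  exact bCoeff_of_mul f m j α

/-! ### Weighted shifts on `ℓ²` -/

section Shift

variable {ι : Type v} {H : Type u} [NormedAddCommGroup H] [InnerProductSpace ℂ H]

/-- The family with value `w a • x a` at `σ a`, and `0` off the range of `σ`. -/
def shiftFun (σ : ι → ι) (w : ι → ℝ) (x : ι → H) : ι → H :=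
  Function.extend σ (fun a => (w a : ℂ) • x a) 0

theorem shiftFun_apply {σ : ι → ι} (hσ : Function.Injective σ) (w : ι → ℝ) (x : ι → H) (a : ι) :
    shiftFun σ w x (σ a) = (w a : ℂ) • x a :=
  hσ.extend_apply _ _ _

theorem shiftFun_of_notMem (σ : ι → ι) (w : ι → ℝ) (x : ι → H) {b : ι} (hb : b ∉ Set.range σ) :
    shiftFun σ w x b = 0 := by
  unfold shiftFun
  rw [Function.extend_apply' _ _ _ hb]
  rfl

theorem norm_sq_summable {H : Type u} [NormedAddCommGroup H] (x : lp (fun _ : ι => H) 2) : Summable fun a => ‖x a‖ ^ 2 := by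
  have := (lp.memℓp x).summable (by norm_num)
  simpa using this

theorem norm_sq_eq {H : Type u} [NormedAddCommGroup H] (x : lp (fun _ : ι => H) 2) : ‖x‖ ^ 2 = ∑' a, ‖x a‖ ^ 2 := by
  have := lp.norm_rpow_eq_tsum (p := 2) (by norm_num) x
  simpa using this

theorem shift_term_le (w : ι → ℝ) {C : ℝ} (hC : ∀ a, |w a| ≤ C) (x : ι → H) (a : ι) :
    ‖(w a : ℂ) • x a‖ ^ 2 ≤ C ^ 2 * ‖x a‖ ^ 2 := by
  rw [norm_smul, mul_pow, Complex.norm_real, Real.norm_eq_abs]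
  exact mul_le_mul_of_nonneg_right (pow_le_pow_left₀ (abs_nonneg _) (hC a) 2) (by positivity)

theorem shiftFun_summable {σ : ι → ι} (hσ : Function.Injective σ) (w : ι → ℝ) {C : ℝ}
    (hC : ∀ a, |w a| ≤ C) (x : lp (fun _ : ι => H) 2) :
    Summable fun b => ‖shiftFun σ w x b‖ ^ 2 := by
  rw [← hσ.summable_iff]
  · refine Summable.of_nonneg_of_le (fun _ => sq_nonneg _) (fun a => ?_)
      ((norm_sq_summable x).mul_left (C ^ 2))
    simp only [Function.comp, shiftFun_apply hσ]
    exact shift_term_le w hC x a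
  · intro b hb
    rw [shiftFun_of_notMem _ _ _ hb]
    simp

theorem shiftFun_memlp {σ : ι → ι} (hσ : Function.Injective σ) (w : ι → ℝ) {C : ℝ}
    (hC : ∀ a, |w a| ≤ C) (x : lp (fun _ : ι => H) 2) :
    Memℓp (E := fun _ : ι => H) (shiftFun σ w x) 2 := by
  refine memℓp_gen ?_
  simpa using shiftFun_summable hσ w hC x

/-- The bounded operator on `ℓ²(ι; H)` which sends the family `x` to the family with value
`w a • x a` at `σ a` and `0` off the range of `σ`; so `e_a ⊗ h ↦ w a • e_{σ a} ⊗ h`. -/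
def weightedShift (σ : ι → ι) (hσ : Function.Injective σ) (w : ι → ℝ) (C : ℝ)
    (hC : ∀ a, |w a| ≤ C) : lp (fun _ : ι => H) 2 →L[ℂ] lp (fun _ : ι => H) 2 :=
  LinearMap.mkContinuous
    { toFun := fun x => ⟨shiftFun σ w x, shiftFun_memlp hσ w hC x⟩
      map_add' := by
        intro x y
        ext b
        by_cases hb : b ∈ Set.range σ
        · obtain ⟨a, rfl⟩ := hb
          change shiftFun σ w (⇑(x + y)) (σ a) = shiftFun σ w x (σ a) + shiftFun σ w y (σ a)
          simp only [shiftFun_apply hσ, lp.coeFn_add, Pi.add_apply, smul_add]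
        · change shiftFun σ w (⇑(x + y)) b = shiftFun σ w x b + shiftFun σ w y b
          simp only [shiftFun_of_notMem _ _ _ hb, add_zero]
      map_smul' := by
        intro c x
        ext b
        by_cases hb : b ∈ Set.range σ
        · obtain ⟨a, rfl⟩ := hb
          change shiftFun σ w (⇑(c • x)) (σ a) = c • shiftFun σ w x (σ a)
          simp only [shiftFun_apply hσ, lp.coeFn_smul, Pi.smul_apply, smul_smul, mul_comm]
        · change shiftFun σ w (⇑(c • x)) b = c • shiftFun σ w x b
          simp only [shiftFun_of_notMem _ _ _ hb, smul_zero] }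
    |C| (by
      intro x
      refine abs_le_of_sq_le_sq' ?_ (by positivity) |>.2
      rw [mul_pow, sq_abs, norm_sq_eq, norm_sq_eq, ← tsum_mul_left]
      have h1 : ∑' b, ‖shiftFun σ w x b‖ ^ 2 = ∑' a, ‖shiftFun σ w x (σ a)‖ ^ 2 := by
        refine (hσ.tsum_eq (f := fun b => ‖shiftFun σ w x b‖ ^ 2) ?_).symm
        intro b hb
        by_contra hb'
        exact hb (by simp [shiftFun_of_notMem _ _ _ hb'])
      refine h1.le.trans ?_
      refine Summable.tsum_le_tsum (fun a => ?_)
        ((shiftFun_summable hσ w hC x).comp_injective hσ) ((norm_sq_summable x).mul_left _)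
      rw [shiftFun_apply hσ]
      exact shift_term_le w hC x a)

theorem weightedShift_apply (σ : ι → ι) (hσ : Function.Injective σ) (w : ι → ℝ) (C : ℝ)
    (hC : ∀ a, |w a| ≤ C) (x : lp (fun _ : ι => H) 2) (a : ι) :
    weightedShift σ hσ w C hC x (σ a) = (w a : ℂ) • x a :=
  shiftFun_apply hσ w x a

theorem weightedShift_apply_of_notMem (σ : ι → ι) (hσ : Function.Injective σ) (w : ι → ℝ) (C : ℝ)
    (hC : ∀ a, |w a| ≤ C) (x : lp (fun _ : ι => H) 2) {b : ι} (hb : b ∉ Set.range σ) :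
    weightedShift σ hσ w C hC x b = 0 :=
  shiftFun_of_notMem σ w x hb

end Shift

/-! ### Fock spaces and their tensor products -/

/-- The full Fock space `F²(H_n)`, as the Hilbert space with orthonormal basis `(e_α)` indexed by
the words in `n` letters. -/
abbrev Fock (n : ℕ) : Type :=
  lp (fun _ : FreeMonoid (Fin n) => ℂ) 2

/-- The Hilbert tensor product `(F²(H_{n_1}) ⊗ ⋯ ⊗ F²(H_{n_k})) ⊗ H`, as the space of square
summable families `(h_{α_1, …, α_k})` in `H`; such a family stands for
`∑ e_{α_1} ⊗ ⋯ ⊗ e_{α_k} ⊗ h_{α_1, …, α_k}`. See `pureTensor`, `inner_pureTensor` and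
`span_pureTensor_dense` for the identification with the Hilbert tensor product. -/
abbrev PolyFock {k : ℕ} (n : Fin k → ℕ) (H : Type u) [NormedAddCommGroup H] : Type u :=
  lp (fun _ : (∀ i, FreeMonoid (Fin (n i))) => H) 2

theorem hasSum_pi_prod {k : ℕ} {β : Fin k → Type v} (g : ∀ i, β i → ℂ)
    (hg : ∀ i, Summable fun a => ‖g i a‖) :
    (Summable fun α : ∀ i, β i => ‖∏ i, g i (α i)‖) ∧
      ∑' α : ∀ i, β i, ∏ i, g i (α i) = ∏ i, ∑' a, g i a := by
  induction k with
  | zero =>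
    exact ⟨(hasSum_fintype _).summable, by simp⟩
  | succ k ih =>
    obtain ⟨h1, h2⟩ := ih (fun i => g i.succ) (fun i => hg i.succ)
    have e : ∀ x : β 0 × (∀ i : Fin k, β i.succ),
        ∏ i, g i (Fin.consEquiv β x i) = g 0 x.1 * ∏ i : Fin k, g i.succ (x.2 i) := by
      intro x
      rw [Fin.prod_univ_succ]
      simp [Fin.consEquiv]
    constructor
    · rw [← (Fin.consEquiv β).summable_iff]
      refine ((hg 0).mul_norm h1).congr ?_
      intro x
      simp only [Function.comp, e]
    · rw [← (Fin.consEquiv β).tsum_eq]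
      simp only [e]
      rw [Fin.prod_univ_succ, ← h2, tsum_mul_tsum_of_summable_norm (hg 0) h1]

section Tensor

variable {k : ℕ} {n : Fin k → ℕ} {H : Type u} [NormedAddCommGroup H] [InnerProductSpace ℂ H]

theorem pureTensor_memlp (x : ∀ i, Fock (n i)) (h : H) :
    Memℓp (E := fun _ : (∀ i, FreeMonoid (Fin (n i))) => H)
      (fun α => (∏ i, x i (α i)) • h) 2 := by
  refine memℓp_gen ?_
  have := (hasSum_pi_prod (fun i a => (x i a) ^ 2)
    (fun i => by simpa using norm_sq_summable (x i))).1
  refine (this.mul_right (‖h‖ ^ 2)).congr ?_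
  intro α
  simp [norm_smul, mul_pow, Finset.prod_pow]

/-- The elementary tensor `x₁ ⊗ ⋯ ⊗ x_k ⊗ h`. -/
def pureTensor (x : ∀ i, Fock (n i)) (h : H) : PolyFock n H :=
  ⟨fun α => (∏ i, x i (α i)) • h, pureTensor_memlp x h⟩

theorem pureTensor_apply (x : ∀ i, Fock (n i)) (h : H) (α : ∀ i, FreeMonoid (Fin (n i))) :
    pureTensor x h α = (∏ i, x i (α i)) • h := rfl

theorem inner_pureTensor (x y : ∀ i, Fock (n i)) (h h' : H) :
    inner ℂ (pureTensor x h) (pureTensor y h') = (∏ i, inner ℂ (x i) (y i)) * inner ℂ h h' := by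
  have hs : ∀ i, Summable fun a => ‖inner ℂ (x i a) (y i a)‖ := by
    intro i
    refine Summable.of_nonneg_of_le (fun _ => norm_nonneg _) (fun a => ?_)
      ((norm_sq_summable (x i)).add (norm_sq_summable (y i)))
    refine (norm_inner_le_norm _ _).trans ?_
    nlinarith [sq_nonneg (‖x i a‖ - ‖y i a‖), sq_nonneg (‖x i a‖ + ‖y i a‖)]
  have := (hasSum_pi_prod (fun i a => (inner ℂ (x i a) (y i a) : ℂ)) hs).2
  simp only [lp.inner_eq_tsum]
  rw [← this, ← tsum_mul_right]
  refine tsum_congr fun α => ?_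
  rw [pureTensor_apply, pureTensor_apply, inner_smul_left, inner_smul_right, map_prod, ← mul_assoc,
    ← Finset.prod_mul_distrib]
  congr 1
  refine Finset.prod_congr rfl fun i _ => ?_
  simp [mul_comm]

open Classical in
theorem pureTensor_single (α : ∀ i, FreeMonoid (Fin (n i))) (h : H) :
    pureTensor (fun i => lp.single 2 (α i) (1 : ℂ)) h = lp.single 2 α h := by
  ext β
  rw [pureTensor_apply]
  by_cases hβ : β = α
  · subst hβ
    simp
  · obtain ⟨i, hi⟩ := Function.ne_iff.1 hβ
    rw [lp.single_apply_ne _ _ _ hβ, Finset.prod_eq_zero (Finset.mem_univ i), zero_smul]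
    exact lp.single_apply_ne _ _ _ hi

open Classical in
theorem span_pureTensor_dense :
    (Submodule.span ℂ (Set.range fun z : (∀ i, Fock (n i)) × H => pureTensor z.1 z.2)
      ).topologicalClosure = ⊤ := by
  rw [eq_top_iff]
  intro x _
  have hx := lp.hasSum_single (p := 2) (by norm_num) x
  refine (Submodule.isClosed_topologicalClosure _).mem_of_tendsto hx (Eventually.of_forall ?_)
  intro s
  refine Submodule.sum_mem _ fun α _ => Submodule.le_topologicalClosure _ (Submodule.subset_span ?_)
  exact ⟨(_, x α), pureTensor_single α (x α)⟩

end Tensor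

/-! ### The universal model -/

theorem of_mul_injective {n : ℕ} (j : Fin n) :
    Function.Injective fun α : FreeMonoid (Fin n) => FreeMonoid.of j * α := by
  intro α β h
  exact mul_left_cancel h

/-- The weighted left creation operator `W_{i,j}` on `F²(H_n)`:
`e_α ↦ (√b_α / √b_{g_j α}) e_{g_j α}`. -/
def leftCreation {n : ℕ} (f : PositiveRegular n) (m : ℕ) (j : Fin n) : Fock n →L[ℂ] Fock n :=
  weightedShift (fun α => FreeMonoid.of j * α) (of_mul_injective j) (weight f m j)
    (1 / √(f.coeff (FreeMonoid.of j))) (abs_weight_le f m j)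

/-- `(α_1, …, α_k) ↦ (α_1, …, g_j α_i, …, α_k)` -/
def leftMul {k : ℕ} {n : Fin k → ℕ} (i : Fin k) (j : Fin (n i))
    (α : ∀ i, FreeMonoid (Fin (n i))) : ∀ i, FreeMonoid (Fin (n i)) :=
  Function.update α i (FreeMonoid.of j * α i)

theorem leftMul_injective {k : ℕ} {n : Fin k → ℕ} (i : Fin k) (j : Fin (n i)) :
    Function.Injective (leftMul (n := n) i j) := by
  intro α β h
  funext l
  have hl := congrFun h l
  unfold leftMul at hl
  by_cases e : l = i
  · subst e
    simpa using hl
  · simpa [e] using hl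

section Model

variable {k : ℕ} {n : Fin k → ℕ} (f : ∀ i, PositiveRegular (n i)) (m : Fin k → ℕ)
  (H : Type u) [NormedAddCommGroup H] [InnerProductSpace ℂ H]

/-- The operator `𝐖_{i,j} ⊗ I_H`, where `𝐖_{i,j} = I ⊗ ⋯ ⊗ W_{i,j} ⊗ ⋯ ⊗ I` with `W_{i,j}` at the
`i`-th place; see `model_pureTensor`. -/
def model (i : Fin k) (j : Fin (n i)) : PolyFock n H →L[ℂ] PolyFock n H :=
  weightedShift (leftMul i j) (leftMul_injective i j) (fun α => weight (f i) (m i) j (α i))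
    (1 / √((f i).coeff (FreeMonoid.of j))) (fun α => abs_weight_le (f i) (m i) j (α i))

theorem model_pureTensor (i : Fin k) (j : Fin (n i)) (x : ∀ i, Fock (n i)) (h : H) :
    model f m H i j (pureTensor x h) =
      pureTensor (Function.update x i (leftCreation (f i) (m i) j (x i))) h := by
  have split : ∀ (y : ∀ i, Fock (n i)) (β : ∀ i, FreeMonoid (Fin (n i))),
      ∏ l, y l (β l) = y i (β i) * ∏ l ∈ Finset.univ.erase i, y l (β l) := by
    intro y β
    exact (Finset.mul_prod_erase _ (fun l => y l (β l)) (Finset.mem_univ i)).symm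
  ext β
  by_cases hβ : β ∈ Set.range (leftMul i j)
  · obtain ⟨α, rfl⟩ := hβ
    refine (weightedShift_apply (leftMul i j) (leftMul_injective i j) _ _ _ _ α).trans ?_
    rw [pureTensor_apply, pureTensor_apply, smul_smul]
    congr 1
    rw [split, split]
    have e1 : leftMul i j α i = FreeMonoid.of j * α i := by simp [leftMul]
    have e2 : leftCreation (f i) (m i) j (x i) (FreeMonoid.of j * α i)
        = (weight (f i) (m i) j (α i) : ℂ) • x i (α i) :=
      weightedShift_apply _ (of_mul_injective j) _ _ (abs_weight_le (f i) (m i) j) (x i) (α i)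
    rw [e1, Function.update_self, e2, smul_eq_mul, mul_assoc]
    congr 2
    refine Finset.prod_congr rfl fun l hl => ?_
    have hne : l ≠ i := (Finset.mem_erase.1 hl).1
    simp [leftMul, hne]
  · refine (weightedShift_apply_of_notMem (leftMul i j) (leftMul_injective i j) _ _ _ _ hβ).trans ?_
    rw [pureTensor_apply, split]
    have e3 : leftCreation (f i) (m i) j (x i) (β i) = 0 := by
      refine weightedShift_apply_of_notMem _ (of_mul_injective j) _ _ _ _ ?_
      rintro ⟨γ, hγ⟩
      refine hβ ⟨Function.update β i γ, ?_⟩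
      funext l
      by_cases e : l = i
      · subst e
        simpa [leftMul] using hγ
      · simp [leftMul, e]
    simp [e3]

end Model

/-! ### The completely positive maps `Φ_{f,X}` and the defect mappings -/

section Defect

variable {K : Type u} [NormedAddCommGroup K] [InnerProductSpace ℂ K] [CompleteSpace K]

/-- `∑_{1 ≤ l ≤ N} ∑_{|α| = l} a_α X_α Y X_α^*`, where `X_α = X_{j_1} ⋯ X_{j_l}` for
`α = g_{j_1} ⋯ g_{j_l}`. -/
def phiPartialSum {n : ℕ} (f : PositiveRegular n) (X : Fin n → K →L[ℂ] K) (Y : K →L[ℂ] K)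
    (N : ℕ) : K →L[ℂ] K :=
  ∑ l ∈ Finset.Icc 1 N, ∑ w : Fin l → Fin n,
    (f.coeff (FreeMonoid.ofList (List.ofFn w)) : ℂ) •
      (FreeMonoid.lift X (FreeMonoid.ofList (List.ofFn w)) ∘L Y ∘L
        ContinuousLinearMap.adjoint (FreeMonoid.lift X (FreeMonoid.ofList (List.ofFn w))))

/-- `Φ_{f,X}(Y) = ∑_{l ≥ 1} ∑_{|α| = l} a_α X_α Y X_α^*`, the limit being taken in the weak
operator topology (with an unspecified value where the series does not converge). -/
def phi {n : ℕ} (f : PositiveRegular n) (X : Fin n → K →L[ℂ] K) (Y : K →L[ℂ] K) : K →L[ℂ] K :=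
  ContinuousLinearMapWOT.toCLM
    (limUnder atTop fun N : ℕ =>
      (ContinuousLinearMapWOT.ofCLM (phiPartialSum f X Y N) : K →WOT[ℂ] K))

/-- `Δ^p_{f,T}(Y) = (id - Φ_{f_1,T_1})^{p_1} ⋯ (id - Φ_{f_k,T_k})^{p_k} (Y)`. -/
def defect {k : ℕ} {n : Fin k → ℕ} (f : ∀ i, PositiveRegular (n i))
    (T : ∀ i, Fin (n i) → K →L[ℂ] K) (p : Fin k → ℕ) (Y : K →L[ℂ] K) : K →L[ℂ] K :=
  Fin.foldr k (fun i Z => (fun Z' => Z' - phi (f i) (T i) Z')^[p i] Z) Y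

/-- `T_{i,p} T_{j,q}^* = T_{j,q}^* T_{i,p}` whenever `i ≠ j`. -/
def DoublyCommuting {k : ℕ} {n : Fin k → ℕ} (T : ∀ i, Fin (n i) → K →L[ℂ] K) : Prop :=
  ∀ i j, i ≠ j → ∀ (p : Fin (n i)) (q : Fin (n j)),
    T i p ∘L ContinuousLinearMap.adjoint (T j q) = ContinuousLinearMap.adjoint (T j q) ∘L T i p

/-- The restriction of an operator to an invariant subspace. -/
def restrictTo (T : K →L[ℂ] K) (M : Submodule ℂ K) (hM : ∀ x ∈ M, T x ∈ M) : M →L[ℂ] M :=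
  (T ∘L M.subtypeL).codRestrict M fun x => hM x x.2

end Defect

/-! ### Multi-analytic operators and Beurling type subspaces -/

section MultiAnalytic

/-- A partial isometry: isometric on the orthogonal complement of the kernel. -/
def IsPartialIsometry {K : Type u} {L : Type v} [NormedAddCommGroup K] [InnerProductSpace ℂ K]
    [NormedAddCommGroup L] [InnerProductSpace ℂ L] (V : K →L[ℂ] L) : Prop :=
  ∀ x ∈ (LinearMap.ker (V : K →ₗ[ℂ] L))ᗮ, ‖V x‖ = ‖x‖

variable {k : ℕ} {n : Fin k → ℕ} (f : ∀ i, PositiveRegular (n i)) (m : Fin k → ℕ)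

/-- `A (𝐖_{i,j} ⊗ I_E) = (𝐖_{i,j} ⊗ I_H) A` for all `i, j`. -/
def IsMultiAnalytic {E : Type u} {H : Type v} [NormedAddCommGroup E] [InnerProductSpace ℂ E]
    [NormedAddCommGroup H] [InnerProductSpace ℂ H] (A : PolyFock n E →L[ℂ] PolyFock n H) : Prop :=
  ∀ (i : Fin k) (j : Fin (n i)), A ∘L model f m E i j = model f m H i j ∘L A

/-- An inner multi-analytic operator is a multi-analytic partial isometry. -/
def IsInnerMultiAnalytic {E : Type u} {H : Type v} [NormedAddCommGroup E] [InnerProductSpace ℂ E]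
    [NormedAddCommGroup H] [InnerProductSpace ℂ H] (A : PolyFock n E →L[ℂ] PolyFock n H) : Prop :=
  IsMultiAnalytic f m A ∧ IsPartialIsometry A

/-- `M` is the range of an inner multi-analytic operator `(⊗ F²(H_{n_i})) ⊗ E → (⊗ F²(H_{n_i})) ⊗ H`
for some Hilbert space `E`. -/
def IsBeurlingType {H : Type u} [NormedAddCommGroup H] [InnerProductSpace ℂ H]
    (M : Submodule ℂ (PolyFock n H)) : Prop :=
  ∃ (E : Type u) (_ : NormedAddCommGroup E) (_ : InnerProductSpace ℂ E) (_ : CompleteSpace E)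
    (Ψ : PolyFock n E →L[ℂ] PolyFock n H),
    IsInnerMultiAnalytic f m Ψ ∧ (M : Set (PolyFock n H)) = Set.range Ψ

end MultiAnalytic

end Polydomain

end

/-!
Expand `∏ i, (1 - f_i)^{-m_i}` as a power series: its coefficients are the weights
`b_β = ∏ i, b_{i,β_i}` that define the model operators. On a vector that all but finitely many words
`W_β†` annihilate, every series is a finite sum, so there the equation `Δ^m(Y) = D` can be inverted
formally to `Y = ∑ b_β W_β D W_β†`. Finitely supported families in the Fock space are such vectors,
and they are dense.

If `Δ^m(Y) = C† C`, this says that `B x = (√b_β C W_β† x)_β` satisfies `B† B = Y`, and the weights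
are exactly what makes `B†` intertwine the model operators. Conversely the same inversion identifies
`Δ^p(1)` for `p ≤ m`: its expansion has the coefficients of `∏ i, (1 - f_i)^{p_i - m_i}` and is
therefore positive, and `Δ^p(A A†) = A Δ^p(1) A†` for `A` multi-analytic. A partial isometry is an
operator `V` for which `V V†` is a projection, which turns the factorization into the criterion for
Beurling type subspaces. In the doubly commuting case `Δ^p(P_M) = V Δ^p(1) V†`, where `V` is the
inclusion of `M` and `Δ^p(1)`, formed from the restrictions, is a product of commuting positive
operators `1 - Φ_i(1)`.
-/

noncomputable section

namespace Polydomain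

open Finset.HasMulAntidiagonal (mulAntidiagonal mem_mulAntidiagonal)
open scoped InnerProductSpace ComplexOrder

local postfix:max "†" => ContinuousLinearMap.adjoint

/-! ### The coefficients of `(1 - f)^{-r}` -/

section Coefficients

open scoped Classical in
instance {A : Type*} : Finset.HasMulAntidiagonal (FreeMonoid A) where
  mulAntidiagonal α := (Finset.range (α.length + 1)).image fun s =>
    (FreeMonoid.ofList (α.toList.take s), FreeMonoid.ofList (α.toList.drop s))
  mem_mulAntidiagonal := by
    rintro α ⟨β, γ⟩
    simp only [Finset.mem_image, Finset.mem_range, Prod.mk.injEq]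
    constructor
    · rintro ⟨s, -, rfl, rfl⟩
      rw [← FreeMonoid.ofList_append, List.take_append_drop, FreeMonoid.ofList_toList]
    · rintro rfl
      exact ⟨β.length, by simp [Order.lt_add_one_iff], by simp [FreeMonoid.length],
        by simp [FreeMonoid.length]⟩

variable {A R : Type*}

open scoped Classical in
/-- The factorisations of a word into nonempty words. -/
def factorizations (α : FreeMonoid A) : Finset (List (FreeMonoid A)) :=
  Finset.univ.image fun c : Composition α.length =>
    (α.toList.splitWrtComposition c).map FreeMonoid.ofList

theorem mem_factorizations {α : FreeMonoid A} {L : List (FreeMonoid A)} :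
    L ∈ factorizations α ↔ 1 ∉ L ∧ L.prod = α := by
  simp only [factorizations, Finset.mem_image, Finset.mem_univ, true_and]
  constructor
  · rintro ⟨c, rfl⟩
    refine ⟨fun h => ?_, ?_⟩
    · obtain ⟨γ, hγ, h1⟩ := List.mem_map.1 h
      have hpos := List.length_pos_of_mem_splitWrtComposition (l := α.toList) (c := c) hγ
      have hlen : γ.length = 0 := congrArg FreeMonoid.length h1
      omega
    · exact (FreeMonoid.ofList_flatten _).symm.trans
        (congrArg FreeMonoid.ofList (List.flatten_splitWrtComposition α.toList c))
  · rintro ⟨hL, rfl⟩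
    obtain ⟨L, rfl⟩ : ∃ l : List (List A), l.map FreeMonoid.ofList = L :=
      ⟨L.map FreeMonoid.toList, by simp⟩
    rw [← FreeMonoid.ofList_flatten]
    let c : Composition L.flatten.length :=
      { blocks := L.map List.length
        blocks_pos := by
          intro i hi
          obtain ⟨γ, hγ, rfl⟩ := List.mem_map.1 hi
          refine List.length_pos_of_ne_nil ?_
          rintro rfl
          exact hL (List.mem_map_of_mem hγ)
        blocks_sum := List.length_flatten.symm }
    exact ⟨c, congrArg _ (List.splitWrtComposition_flatten L c rfl)⟩

theorem factorizations_one : factorizations (1 : FreeMonoid A) = {[]} := by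
  ext L
  rw [mem_factorizations, Finset.mem_singleton]
  cases L with
  | nil => simp
  | cons γ L => simp +contextual [eq_comm]

theorem cons_mem_factorizations {α γ : FreeMonoid A} {L : List (FreeMonoid A)} :
    γ :: L ∈ factorizations α ↔
      γ ≠ 1 ∧ (γ, L.prod) ∈ mulAntidiagonal α ∧ L ∈ factorizations L.prod := by
  simp only [mem_factorizations, List.mem_cons, not_or, List.prod_cons,
    mem_mulAntidiagonal, and_true, eq_comm (a := (1 : FreeMonoid A))]
  tauto

/-- The coefficient of `α` in the power series `∑ p, g p * f ^ p`, where `f = ∑ a α * Z α`. -/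
def compCoeff [Semiring R] (a : FreeMonoid A → R) (g : ℕ → R) (α : FreeMonoid A) : R :=
  ∑ L ∈ factorizations α, (L.map a).prod * g L.length

theorem compCoeff_one [Semiring R] (a : FreeMonoid A → R) (g : ℕ → R) :
    compCoeff a g 1 = g 0 := by
  simp [compCoeff, factorizations_one]

theorem compCoeff_of_ne_one [Semiring R] {a : FreeMonoid A → R} (ha : a 1 = 0) (g : ℕ → R)
    {α : FreeMonoid A} (hα : α ≠ 1) :
    compCoeff a g α = ∑ p ∈ mulAntidiagonal α, a p.1 * compCoeff a (fun q => g (q + 1)) p.2 := by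
  simp only [compCoeff, Finset.mul_sum]
  rw [Finset.sum_sigma']
  symm
  refine Finset.sum_bij_ne_zero (fun x _ _ => x.1.1 :: x.2) ?_ ?_ ?_ ?_
  · rintro ⟨⟨γ, δ⟩, L⟩ hL h0
    obtain ⟨h1, h2⟩ := Finset.mem_sigma.1 hL
    obtain rfl : L.prod = δ := (mem_factorizations.1 h2).2
    refine cons_mem_factorizations.2 ⟨?_, h1, h2⟩
    rintro rfl
    exact h0 (by rw [ha, zero_mul])
  · rintro ⟨⟨γ, δ⟩, L⟩ hL _ ⟨⟨γ', δ'⟩, L'⟩ hL' _ h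
    obtain rfl : L.prod = δ := (mem_factorizations.1 (Finset.mem_sigma.1 hL).2).2
    obtain rfl : L'.prod = δ' := (mem_factorizations.1 (Finset.mem_sigma.1 hL').2).2
    obtain ⟨rfl, rfl⟩ := List.cons.inj h
    rfl
  · rintro (_ | ⟨γ, L⟩) hL h0
    · exact absurd (mem_factorizations.1 hL).2.symm hα
    · obtain ⟨_, h1, h2⟩ := cons_mem_factorizations.1 hL
      exact ⟨⟨(γ, L.prod), L⟩, Finset.mem_sigma.2 ⟨h1, h2⟩, by simpa [mul_assoc] using h0, rfl⟩
  · rintro ⟨⟨γ, δ⟩, L⟩ _ _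
    simp [mul_assoc]

/-- The coefficients of the power series `(1 - f)^{-r}`, where `f = ∑ a α * Z α`. -/
def invPowCoeff [Semiring R] (a : FreeMonoid A → R) (r : ℕ) : FreeMonoid A → R :=
  compCoeff a fun p => (r.multichoose p : R)

theorem invPowCoeff_one [Semiring R] (a : FreeMonoid A → R) (r : ℕ) : invPowCoeff a r 1 = 1 := by
  simp [invPowCoeff, compCoeff_one]

theorem invPowCoeff_zero [Semiring R] {a : FreeMonoid A → R} (ha : a 1 = 0) {α : FreeMonoid A}
    (hα : α ≠ 1) : invPowCoeff a 0 α = 0 := by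
  rw [invPowCoeff, compCoeff_of_ne_one ha _ hα]
  simp [compCoeff]

theorem invPowCoeff_succ [Semiring R] {a : FreeMonoid A → R} (ha : a 1 = 0) (r : ℕ)
    (α : FreeMonoid A) :
    invPowCoeff a (r + 1) α = invPowCoeff a r α +
      ∑ p ∈ mulAntidiagonal α, a p.1 * invPowCoeff a (r + 1) p.2 := by
  by_cases hα : α = 1
  · subst hα
    have h : ∀ p ∈ mulAntidiagonal (1 : FreeMonoid A), a p.1 * invPowCoeff a (r + 1) p.2 = 0 := by
      intro p hp
      have hp1 : p.1 = 1 := (List.append_eq_nil_iff.1 (mem_mulAntidiagonal.1 hp)).1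
      rw [hp1, ha, zero_mul]
    rw [Finset.sum_eq_zero h, invPowCoeff_one, invPowCoeff_one, add_zero]
  · simp only [invPowCoeff, compCoeff_of_ne_one ha _ hα, ← Finset.sum_add_distrib, ← mul_add]
    refine Finset.sum_congr rfl fun p _ => ?_
    simp only [compCoeff, ← Finset.sum_add_distrib, ← mul_add, Nat.multichoose_succ_succ,
      Nat.cast_add]

theorem invPowCoeff_nonneg {a : FreeMonoid A → ℝ} (ha : ∀ α, 0 ≤ a α) (r : ℕ)
    (α : FreeMonoid A) : 0 ≤ invPowCoeff a r α := by
  unfold invPowCoeff compCoeff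
  refine Finset.sum_nonneg fun L _ => mul_nonneg (List.prod_nonneg fun x hx => ?_)
    (Nat.cast_nonneg _)
  obtain ⟨γ, -, rfl⟩ := List.mem_map.1 hx
  exact ha γ

theorem invPowCoeff_eq_bCoeff {n : ℕ} (a : FreeMonoid (Fin n) → ℝ) {m : ℕ} (hm : 1 ≤ m)
    (α : FreeMonoid (Fin n)) : invPowCoeff a m α = bCoeff a m α := by
  classical
  have hinj : Function.Injective fun c : Composition α.length =>
      (α.toList.splitWrtComposition c).map FreeMonoid.ofList := fun c d h => by
    have hsplit := List.map_injective_iff.2 FreeMonoid.ofList.injective h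
    exact Composition.ext ((List.map_length_splitWrtComposition α.toList c).symm.trans
      ((congrArg (List.map List.length) hsplit).trans
        (List.map_length_splitWrtComposition α.toList d)))
  rw [invPowCoeff, compCoeff, factorizations, Finset.sum_image hinj.injOn]
  refine Finset.sum_congr rfl fun c _ => ?_
  have hchoose : m.multichoose c.length = (c.length + m - 1).choose (m - 1) := by
    rw [Nat.multichoose_eq, add_comm, Nat.choose_symm_of_eq_add]
    omega
  rw [List.map_map, List.length_map, List.length_splitWrtComposition, hchoose]
  rfl

end Coefficients

/-! ### The maps `Φ_{f,X}` for row contractions -/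

section Column

variable {ι K E : Type*} [NormedAddCommGroup K] [InnerProductSpace ℂ K]
  [NormedAddCommGroup E] [InnerProductSpace ℂ E]

theorem exists_column (T : ι → K →L[ℂ] E) {C : ℝ} (hC : 0 ≤ C)
    (hT : ∀ (s : Finset ι) (x : K), ∑ a ∈ s, ‖T a x‖ ^ 2 ≤ C ^ 2 * ‖x‖ ^ 2) :
    ∃ R : K →L[ℂ] lp (fun _ : ι => E) 2, ∀ x a, R x a = T a x := by
  have hmem (x : K) : Memℓp (E := fun _ : ι => E) (fun a => T a x) 2 := by
    refine memℓp_gen ?_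
    simpa using summable_of_sum_le (fun a => sq_nonneg ‖T a x‖) fun s => hT s x
  let R : K →ₗ[ℂ] lp (fun _ : ι => E) 2 :=
    { toFun := fun x => ⟨fun a => T a x, hmem x⟩
      map_add' := fun x y => by ext a; exact map_add (T a) x y
      map_smul' := fun c x => by ext a; exact map_smul (T a) c x }
  refine ⟨R.mkContinuous C fun x => ?_, fun x a => rfl⟩
  refine abs_le_of_sq_le_sq' ?_ (by positivity) |>.2
  rw [mul_pow, norm_sq_eq]
  exact Real.tsum_le_of_sum_le (fun a => sq_nonneg _) fun s => hT s x

theorem eq_of_inner_self_eq_of_dense {D : Set K} (hD : Dense D) {Y Z : K →L[ℂ] K}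
    (h : ∀ x ∈ D, ⟪x, Y x⟫_ℂ = ⟪x, Z x⟫_ℂ) : Y = Z := by
  have hall : (fun x => ⟪x, Y x⟫_ℂ) = fun x => ⟪x, Z x⟫_ℂ :=
    Continuous.ext_on hD (by fun_prop) (by fun_prop) h
  refine ContinuousLinearMap.coe_injective ((ext_inner_map _ _).1 fun x => ?_)
  rw [← inner_conj_symm, ← inner_conj_symm _ x]
  exact congrArg _ (congrFun hall x)

theorem exists_adjoint_comp_column_eq [CompleteSpace K] [CompleteSpace E] {D : Set K}
    (hD : Dense D) {Y : K →L[ℂ] K} {T : ι → K →L[ℂ] E}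
    (hY : ∀ x ∈ D, HasSum (fun a => ((‖T a x‖ ^ 2 : ℝ) : ℂ)) ⟪x, Y x⟫_ℂ) :
    ∃ B : K →L[ℂ] lp (fun _ : ι => E) 2, B† ∘L B = Y ∧ ∀ x a, B x a = T a x := by
  have hbound (s : Finset ι) (x : K) : ∑ a ∈ s, ‖T a x‖ ^ 2 ≤ √‖Y‖ ^ 2 * ‖x‖ ^ 2 := by
    refine hD.induction (P := fun x => ∑ a ∈ s, ‖T a x‖ ^ 2 ≤ √‖Y‖ ^ 2 * ‖x‖ ^ 2) (fun x hx => ?_)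
      (isClosed_le (by fun_prop) (by fun_prop)) x
    calc ∑ a ∈ s, ‖T a x‖ ^ 2 ≤ Complex.re ⟪x, Y x⟫_ℂ :=
          sum_le_hasSum s (fun a _ => sq_nonneg _) (Complex.hasSum_re (hY x hx))
      _ ≤ ‖⟪x, Y x⟫_ℂ‖ := Complex.re_le_norm _
      _ ≤ ‖x‖ * (‖Y‖ * ‖x‖) := (norm_inner_le_norm _ _).trans (by gcongr; exact Y.le_opNorm x)
      _ = √‖Y‖ ^ 2 * ‖x‖ ^ 2 := by rw [Real.sq_sqrt (norm_nonneg Y)]; ring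
  obtain ⟨B, hB⟩ := exists_column T (Real.sqrt_nonneg _) hbound
  refine ⟨B, eq_of_inner_self_eq_of_dense hD fun x hx => ?_, hB⟩
  rw [← (hY x hx).tsum_eq, ← Complex.ofReal_tsum, ContinuousLinearMap.comp_apply,
    ContinuousLinearMap.adjoint_inner_right, inner_self_eq_norm_sq_to_K,
    tsum_congr fun a => by rw [← hB x a], ← norm_sq_eq]
  exact (Complex.ofReal_pow _ _).symm

end Column

theorem norm_sqrt_smul_sq {E : Type*} [SeminormedAddCommGroup E] [NormedSpace ℂ E] {c : ℝ}
    (hc : 0 ≤ c) (x : E) : ‖((√c : ℝ) : ℂ) • x‖ ^ 2 = c * ‖x‖ ^ 2 := by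
  rw [norm_smul, mul_pow, Complex.norm_real, Real.norm_eq_abs, sq_abs, Real.sq_sqrt hc]

theorem inner_sqrt_smul_sqrt_smul {E : Type*} [SeminormedAddCommGroup E] [InnerProductSpace ℂ E]
    {c : ℝ} (hc : 0 ≤ c) (x y : E) :
    ⟪((√c : ℝ) : ℂ) • x, ((√c : ℝ) : ℂ) • y⟫_ℂ = c * ⟪x, y⟫_ℂ := by
  rw [inner_smul_left, inner_smul_right, Complex.conj_ofReal, ← mul_assoc, ← Complex.ofReal_mul,
    Real.mul_self_sqrt hc]

section Phi

variable {K L : Type*} [NormedAddCommGroup K] [InnerProductSpace ℂ K]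
  [NormedAddCommGroup L] [InnerProductSpace ℂ L]
  {N : ℕ} {f : PositiveRegular N} {X : Fin N → K →L[ℂ] K} {T : Fin N → L →L[ℂ] L}

theorem isPositive_of_dense {D : Set K} (hD : Dense D) {Z : K →L[ℂ] K}
    (h : ∀ x ∈ D, 0 ≤ ⟪x, Z x⟫_ℂ) : Z.IsPositive := by
  have hall (x : K) : 0 ≤ ⟪x, Z x⟫_ℂ :=
    hD.induction (P := fun x => 0 ≤ ⟪x, Z x⟫_ℂ) h (isClosed_le (by fun_prop) (by fun_prop)) x
  refine Z.isPositive_iff_complex.2 fun x => ?_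
  have hx : 0 ≤ ⟪Z x, x⟫_ℂ := by
    rw [← inner_conj_symm]
    exact star_nonneg_iff.2 (hall x)
  exact ⟨(RCLike.nonneg_iff_exists_ofReal.1 hx).elim fun r hr => by simp [← hr.2],
    (RCLike.nonneg_iff.1 hx).1⟩

theorem comp_lift {A : K →L[ℂ] L} (hA : ∀ j, A ∘L X j = T j ∘L A) (α : FreeMonoid (Fin N)) :
    A ∘L FreeMonoid.lift X α = FreeMonoid.lift T α ∘L A := by
  induction α using FreeMonoid.inductionOn' with
  | one => rfl
  | of_mul j α ih =>
    simp only [map_mul, FreeMonoid.lift_eval_of, ContinuousLinearMap.mul_def]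
    rw [← ContinuousLinearMap.comp_assoc, hA, ContinuousLinearMap.comp_assoc, ih,
      ContinuousLinearMap.comp_assoc]

variable [CompleteSpace K] [CompleteSpace L]

theorem adjoint_lift_adjoint_apply {A : K →L[ℂ] L} (hA : ∀ j, A ∘L X j = T j ∘L A)
    (α : FreeMonoid (Fin N)) (y : L) :
    (FreeMonoid.lift X α)† (A† y) = A† ((FreeMonoid.lift T α)† y) := by
  have h := congrArg ContinuousLinearMap.adjoint (comp_lift hA α)
  rw [ContinuousLinearMap.adjoint_comp, ContinuousLinearMap.adjoint_comp] at h
  exact DFunLike.congr_fun h y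

variable (f X) in
/-- `X` is a row contraction with respect to `f` if `Φ_{f,X}(1) ≤ 1`, that is, if the row
`(√a_α X_α)_α` is a contraction. The condition is imposed on the finite partial sums, so that
convergence of `Φ_{f,X}` is not presupposed. -/
def IsRowContraction : Prop :=
  ∀ (s : Finset (FreeMonoid (Fin N))) (x : K),
    ∑ α ∈ s, f.coeff α * ‖(FreeMonoid.lift X α)† x‖ ^ 2 ≤ ‖x‖ ^ 2

theorem IsRowContraction.of_isometry (h : IsRowContraction f T) (J : K →ₗᵢ[ℂ] L)
    (hJ : ∀ j, J.toContinuousLinearMap ∘L X j = T j ∘L J.toContinuousLinearMap) :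
    IsRowContraction f X := by
  intro s x
  have hJJ (y : K) : J.toContinuousLinearMap† (J y) = y := by
    exact DFunLike.congr_fun (LinearIsometry.adjoint_comp_self J) y
  have hnorm : ‖J.toContinuousLinearMap†‖ ≤ 1 :=
    (LinearIsometryEquiv.norm_map _ _).trans_le J.norm_toContinuousLinearMap_le
  calc ∑ α ∈ s, f.coeff α * ‖(FreeMonoid.lift X α)† x‖ ^ 2
      ≤ ∑ α ∈ s, f.coeff α * ‖(FreeMonoid.lift T α)† (J x)‖ ^ 2 := by
        gcongr with α
        · exact f.coeff_nonneg α
        · rw [← hJJ x, adjoint_lift_adjoint_apply hJ, hJJ]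
          exact (ContinuousLinearMap.le_of_opNorm_le _ hnorm _).trans_eq (one_mul _)
    _ ≤ ‖x‖ ^ 2 := by simpa using h s (J x)

theorem IsRowContraction.exists_hasSum (h : IsRowContraction f X) (Y : K →L[ℂ] K) :
    ∃ Z : K →L[ℂ] K, ∀ x y : K, HasSum (fun α => (f.coeff α : ℂ) *
      ⟪(FreeMonoid.lift X α)† x, Y ((FreeMonoid.lift X α)† y)⟫_ℂ) ⟪x, Z y⟫_ℂ := by
  obtain ⟨R, hR⟩ := exists_column
    (fun α => ((√(f.coeff α) : ℝ) : ℂ) • (FreeMonoid.lift X α)†) zero_le_one fun s x => by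
      simpa only [smul_apply, norm_sqrt_smul_sq (f.coeff_nonneg _), one_pow, one_mul] using h s x
  obtain ⟨S, hS⟩ := exists_column
    (fun α => ((√(f.coeff α) : ℝ) : ℂ) • (Y ∘L (FreeMonoid.lift X α)†)) (norm_nonneg Y)
    fun s x => by
      simp only [smul_apply, norm_sqrt_smul_sq (f.coeff_nonneg _)]
      calc _ ≤ ∑ α ∈ s, f.coeff α * (‖Y‖ * ‖(FreeMonoid.lift X α)† x‖) ^ 2 := by
            gcongr with α
            · exact f.coeff_nonneg α
            · exact Y.le_opNorm _
        _ = ‖Y‖ ^ 2 * ∑ α ∈ s, f.coeff α * ‖(FreeMonoid.lift X α)† x‖ ^ 2 := by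
            rw [Finset.mul_sum]
            exact Finset.sum_congr rfl fun α _ => by ring
        _ ≤ ‖Y‖ ^ 2 * ‖x‖ ^ 2 := by gcongr; exact h s x
  refine ⟨R† ∘L S, fun x y => ?_⟩
  rw [ContinuousLinearMap.comp_apply, ContinuousLinearMap.adjoint_inner_right]
  refine (lp.hasSum_inner (𝕜 := ℂ) (R x) (S y)).congr_fun fun α => ?_
  rw [hR, hS]
  exact (inner_sqrt_smul_sqrt_smul (f.coeff_nonneg α) _ _).symm

theorem tendsto_sum_words {A M : Type*} [Fintype A] [AddCommMonoid M] [TopologicalSpace M]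
    [ContinuousAdd M] [RegularSpace M] {g : FreeMonoid A → M} (hg : g 1 = 0) {S : M}
    (h : HasSum g S) :
    Tendsto (fun q : ℕ => ∑ l ∈ Finset.Icc 1 q, ∑ w : Fin l → A,
      g (FreeMonoid.ofList (List.ofFn w))) atTop (𝓝 S) := by
  have hwords : HasSum (fun p : Σ l, Fin l → A => g (FreeMonoid.ofList (List.ofFn p.2))) S :=
    (List.equivSigmaTuple.symm.trans FreeMonoid.ofList).hasSum_iff.2 h
  have hlengths := (hwords.sigma fun l => hasSum_fintype _).tendsto_sum_nat
  refine ((tendsto_add_atTop_iff_nat 1).2 hlengths).congr fun q => ?_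
  have hempty : ∑ w : Fin 0 → A, g (FreeMonoid.ofList (List.ofFn w)) = 0 :=
    Finset.sum_eq_zero fun w _ => by rw [List.ofFn_zero]; exact hg
  rw [Finset.range_eq_Ico, Finset.sum_eq_sum_Ico_succ_bot (Nat.succ_pos q), hempty, zero_add]
  rfl

theorem tendsto_phiPartialSum_of_hasSum {Y Z : K →L[ℂ] K}
    (hZ : ∀ x y : K, HasSum (fun α => (f.coeff α : ℂ) *
      ⟪(FreeMonoid.lift X α)† x, Y ((FreeMonoid.lift X α)† y)⟫_ℂ) ⟪x, Z y⟫_ℂ) :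
    Tendsto (fun q : ℕ =>
      (ContinuousLinearMapWOT.ofCLM (phiPartialSum f X Y q) : K →WOT[ℂ] K)) atTop
      (𝓝 (ContinuousLinearMapWOT.ofCLM Z)) := by
  rw [ContinuousLinearMapWOT.tendsto_iff_forall_inner_apply_tendsto]
  intro y x
  refine (tendsto_sum_words (by rw [f.coeff_one]; simp) (hZ x y)).congr fun q => ?_
  simp only [ContinuousLinearMapWOT.ofCLM_apply, phiPartialSum, sum_apply,
    inner_sum, smul_apply, ContinuousLinearMap.comp_apply, inner_smul_right,
    ContinuousLinearMap.adjoint_inner_left]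

theorem phi_eq_of_hasSum {Y Z : K →L[ℂ] K}
    (hZ : ∀ x y : K, HasSum (fun α => (f.coeff α : ℂ) *
      ⟪(FreeMonoid.lift X α)† x, Y ((FreeMonoid.lift X α)† y)⟫_ℂ) ⟪x, Z y⟫_ℂ) :
    phi f X Y = Z := by
  rw [phi, (tendsto_phiPartialSum_of_hasSum hZ).limUnder_eq]

theorem IsRowContraction.hasSum_inner_phi (h : IsRowContraction f X) (Y : K →L[ℂ] K) (x y : K) :
    HasSum (fun α => (f.coeff α : ℂ) *
      ⟪(FreeMonoid.lift X α)† x, Y ((FreeMonoid.lift X α)† y)⟫_ℂ) ⟪x, phi f X Y y⟫_ℂ := by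
  obtain ⟨Z, hZ⟩ := h.exists_hasSum Y
  exact phi_eq_of_hasSum hZ ▸ hZ x y

theorem IsRowContraction.tendsto_phiPartialSum (h : IsRowContraction f X) (Y : K →L[ℂ] K) :
    Tendsto (fun q : ℕ =>
      (ContinuousLinearMapWOT.ofCLM (phiPartialSum f X Y q) : K →WOT[ℂ] K)) atTop
      (𝓝 (ContinuousLinearMapWOT.ofCLM (phi f X Y))) :=
  tendsto_phiPartialSum_of_hasSum (h.hasSum_inner_phi Y)

theorem IsRowContraction.phi_conj (h : IsRowContraction f X) {A B : K →L[ℂ] L}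
    (hA : ∀ j, A ∘L X j = T j ∘L A) (hB : ∀ j, B ∘L X j = T j ∘L B) (Z : K →L[ℂ] K) :
    phi f T (A ∘L Z ∘L B†) = A ∘L phi f X Z ∘L B† := by
  refine phi_eq_of_hasSum fun x y => ?_
  simp only [ContinuousLinearMap.comp_apply, ← ContinuousLinearMap.adjoint_inner_left A,
    ← adjoint_lift_adjoint_apply hA, ← adjoint_lift_adjoint_apply hB]
  exact h.hasSum_inner_phi Z (A† x) (B† y)

theorem IsRowContraction.isPositive_one_sub_phi_one (h : IsRowContraction f X) :
    (1 - phi f X 1).IsPositive := by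
  refine isPositive_of_dense dense_univ fun x _ => ?_
  rw [sub_apply, inner_sub_right, sub_nonneg]
  refine hasSum_le_of_sum_le (h.hasSum_inner_phi 1 x x) fun s => ?_
  simp only [one_apply_eq_self, inner_self_eq_norm_sq_to_K, Complex.coe_algebraMap]
  exact_mod_cast h s x

end Phi

/-! ### Defect operators of tuples of row contractions -/

section Defects

variable {K L : Type*} [NormedAddCommGroup K] [InnerProductSpace ℂ K] [CompleteSpace K]
  [NormedAddCommGroup L] [InnerProductSpace ℂ L] [CompleteSpace L]
  {k : ℕ} {n : Fin k → ℕ} {f : ∀ i, PositiveRegular (n i)}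
  {X : ∀ i, Fin (n i) → K →L[ℂ] K} {T : ∀ i, Fin (n i) → L →L[ℂ] L}

variable (f X) in
/-- The maps `(id - Φ_{f_i,X_i})^{p_i}` with `i` in the list `l`, composed in the order of `l`. They
allow inductions over the factors of a defect map. -/
def defectAlong (p : Fin k → ℕ) (l : List (Fin k)) (Y : K →L[ℂ] K) : K →L[ℂ] K :=
  l.foldr (fun i Z => (fun Z' => Z' - phi (f i) (X i) Z')^[p i] Z) Y

theorem defectAlong_cons (p : Fin k → ℕ) (i : Fin k) (l : List (Fin k)) (Y : K →L[ℂ] K) :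
    defectAlong f X p (i :: l) Y =
      (fun Z => Z - phi (f i) (X i) Z)^[p i] (defectAlong f X p l Y) :=
  rfl

theorem defect_eq_defectAlong (p : Fin k → ℕ) (Y : K →L[ℂ] K) :
    defect f X p Y = defectAlong f X p (List.finRange k) Y :=
  Fin.foldr_eq_foldr_finRange _ _

theorem defect_conj (hX : ∀ i, IsRowContraction (f i) (X i)) {A : K →L[ℂ] L}
    (hA : ∀ i j, A ∘L X i j = T i j ∘L A) (p : Fin k → ℕ) (Z : K →L[ℂ] K) :
    defect f T p (A ∘L Z ∘L A†) = A ∘L defect f X p Z ∘L A† := by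
  have hstep (i : Fin k) : Function.Semiconj (fun Z => A ∘L Z ∘L A†)
      (fun Z => Z - phi (f i) (X i) Z) fun Z => Z - phi (f i) (T i) Z := fun Z => by
    simp only [(hX i).phi_conj (hA i) (hA i), ContinuousLinearMap.comp_sub,
      ContinuousLinearMap.sub_comp]
  rw [defect_eq_defectAlong, defect_eq_defectAlong]
  exact List.foldr_hom (fun Z => A ∘L Z ∘L A†) fun i Z => ((hstep i).iterate_right (p i) Z).symm

end Defects

section DoublyCommuting

variable {K : Type*} [NormedAddCommGroup K] [InnerProductSpace ℂ K] [CompleteSpace K]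

theorem IsRowContraction.phi_eq_mul {N : ℕ} {f : PositiveRegular N} {X : Fin N → K →L[ℂ] K}
    (h : IsRowContraction f X) {S : K →L[ℂ] K}
    (hS : S ∈ StarSubalgebra.centralizer ℂ (Set.range X)) :
    phi f X S = phi f X 1 * S ∧ phi f X S = S * phi f X 1 := by
  have hcomm {R : K →L[ℂ] K} (hR : R ∈ StarSubalgebra.centralizer ℂ (Set.range X)) (j : Fin N) :
      R ∘L X j = X j ∘L R :=
    (StarSubalgebra.mem_centralizer_iff ℂ |>.1 hR (X j) ⟨j, rfl⟩).1.symm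
  have hone := hcomm (one_mem _)
  constructor
  · have hS' := h.phi_conj hone (hcomm (star_mem hS)) 1
    rwa [ContinuousLinearMap.star_eq_adjoint, ContinuousLinearMap.adjoint_adjoint] at hS'
  · have hS' := h.phi_conj (hcomm hS) hone 1
    rwa [← ContinuousLinearMap.star_eq_adjoint, star_one] at hS'

variable {k : ℕ} {n : Fin k → ℕ} {f : ∀ i, PositiveRegular (n i)}
  {T : ∀ i, Fin (n i) → K →L[ℂ] K}

theorem DoublyCommuting.mem_centralizer (hT : DoublyCommuting T)
    (hcomm : ∀ i j, i ≠ j → ∀ p q, Commute (T i p) (T j q)) {i j : Fin k} (hij : i ≠ j)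
    (p : Fin (n i)) : T i p ∈ StarSubalgebra.centralizer ℂ (Set.range (T j)) := by
  rw [StarSubalgebra.mem_centralizer_iff]
  rintro _ ⟨q, rfl⟩
  exact ⟨hcomm j i hij.symm q p, (hT i j hij p q).symm⟩

theorem DoublyCommuting.phi_one_mem_centralizer (hT : DoublyCommuting T)
    (hcomm : ∀ i j, i ≠ j → ∀ p q, Commute (T i p) (T j q))
    {i j : Fin k} (hij : i ≠ j) (hi : IsRowContraction (f i) (T i)) :
    phi (f i) (T i) 1 ∈ StarSubalgebra.centralizer ℂ (Set.range (T j)) := by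
  rw [StarSubalgebra.mem_centralizer_iff]
  rintro _ ⟨q, rfl⟩
  have hq := hT.mem_centralizer hcomm hij.symm q
  exact ⟨(hi.phi_eq_mul hq).2.symm.trans (hi.phi_eq_mul hq).1,
    (hi.phi_eq_mul (star_mem hq)).2.symm.trans (hi.phi_eq_mul (star_mem hq)).1⟩

theorem DoublyCommuting.defectAlong_one_nonneg_and_mem_centralizer (hT : DoublyCommuting T)
    (hcomm : ∀ i j, i ≠ j → ∀ p q, Commute (T i p) (T j q))
    (h : ∀ i, IsRowContraction (f i) (T i)) {p : Fin k → ℕ} (hp : p ≤ 1)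
    {l : List (Fin k)} (hl : l.Nodup) :
    0 ≤ defectAlong f T p l 1 ∧ ∀ i ∉ l,
      defectAlong f T p l 1 ∈ StarSubalgebra.centralizer ℂ (Set.range (T i)) := by
  induction l with
  | nil =>
    exact ⟨(ContinuousLinearMap.nonneg_iff_isPositive _).2 ContinuousLinearMap.isPositive_one,
      fun i _ => one_mem _⟩
  | cons i l ih =>
    obtain ⟨hi, hl⟩ := List.nodup_cons.1 hl
    obtain ⟨hpos, hmem⟩ := ih hl
    rw [defectAlong_cons]
    set Z := defectAlong f T p l 1
    rcases Nat.le_one_iff_eq_zero_or_eq_one.1 (hp i) with hpi | hpi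
    · rw [hpi]
      exact ⟨hpos, fun j hj => hmem j fun hjl => hj (List.mem_cons_of_mem i hjl)⟩
    · obtain ⟨hleft, hright⟩ := (h i).phi_eq_mul (hmem i hi)
      have hZ : Z - phi (f i) (T i) Z = (1 - phi (f i) (T i) 1) * Z := by
        rw [sub_mul, one_mul, hleft]
      rw [hpi, Function.iterate_one, hZ]
      refine ⟨Commute.mul_nonneg ((ContinuousLinearMap.nonneg_iff_isPositive _).2
        (h i).isPositive_one_sub_phi_one) hpos ?_, fun j hj => ?_⟩
      · exact (Commute.one_left Z).sub_left (hleft.symm.trans hright)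
      · obtain ⟨hji, hjl⟩ := not_or.1 (mt List.mem_cons.2 hj)
        exact mul_mem (sub_mem (one_mem _)
          (hT.phi_one_mem_centralizer hcomm (Ne.symm hji) (h i))) (hmem j hjl)

theorem DoublyCommuting.isPositive_defect_one (hT : DoublyCommuting T)
    (hcomm : ∀ i j, i ≠ j → ∀ p q, Commute (T i p) (T j q))
    (h : ∀ i, IsRowContraction (f i) (T i)) {p : Fin k → ℕ} (hp : p ≤ 1) :
    (defect f T p 1).IsPositive := by
  rw [defect_eq_defectAlong, ← ContinuousLinearMap.nonneg_iff_isPositive]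
  exact (hT.defectAlong_one_nonneg_and_mem_centralizer hcomm h hp (List.nodup_finRange k)).1

end DoublyCommuting

section TupleCoefficients

variable {ι : Type*} {A : ι → Type*}

/-- The coefficients of `∏ i, (1 - f_i)^{-r_i}`, where `f_i = ∑ a i α * Z α`. -/
def polyInvPow [Fintype ι] (a : ∀ i, FreeMonoid (A i) → ℝ) (r : ι → ℕ)
    (β : ∀ i, FreeMonoid (A i)) : ℝ :=
  ∏ i, invPowCoeff (a i) (r i) (β i)

theorem polyInvPow_one [Fintype ι] (a : ∀ i, FreeMonoid (A i) → ℝ) (r : ι → ℕ) :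
    polyInvPow a r 1 = 1 :=
  Finset.prod_eq_one fun i _ => invPowCoeff_one (a i) (r i)

theorem polyInvPow_zero [Fintype ι] {a : ∀ i, FreeMonoid (A i) → ℝ} (ha : ∀ i, a i 1 = 0)
    {β : ∀ i, FreeMonoid (A i)} (hβ : β ≠ 1) : polyInvPow a 0 β = 0 := by
  obtain ⟨i, hi⟩ := Function.ne_iff.1 hβ
  exact Finset.prod_eq_zero (Finset.mem_univ i) (invPowCoeff_zero (ha i) hi)

theorem polyInvPow_nonneg [Fintype ι] {a : ∀ i, FreeMonoid (A i) → ℝ} (ha : ∀ i α, 0 ≤ a i α)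
    (r : ι → ℕ) (β : ∀ i, FreeMonoid (A i)) : 0 ≤ polyInvPow a r β :=
  Finset.prod_nonneg fun i _ => invPowCoeff_nonneg (ha i) (r i) (β i)

variable [DecidableEq ι]

/-- The pairs `(α, γ)` such that `β` is the tuple `γ` with its `i`-th entry multiplied by `α` from
the left. -/
def leftSplits (i : ι) (β : ∀ i, FreeMonoid (A i)) :
    Finset (FreeMonoid (A i) × ∀ i, FreeMonoid (A i)) :=
  (mulAntidiagonal (β i)).map
    ⟨Prod.map id (Function.update β i),
      Function.injective_id.prodMap (Function.update_injective β i)⟩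

theorem mem_leftSplits {i : ι} {β : ∀ i, FreeMonoid (A i)}
    {q : FreeMonoid (A i) × ∀ i, FreeMonoid (A i)} :
    q ∈ leftSplits i β ↔ Pi.mulSingle i q.1 * q.2 = β := by
  obtain ⟨α, γ⟩ := q
  simp only [leftSplits, Finset.mem_map, Function.Embedding.coeFn_mk, Prod.map_apply, id_eq,
    Prod.mk.injEq, Prod.exists, mem_mulAntidiagonal]
  constructor
  · rintro ⟨α, δ, h, rfl, rfl⟩
    funext l
    obtain rfl | hl := eq_or_ne l i <;> simp_all
  · rintro rfl
    refine ⟨α, γ i, by simp, rfl, ?_⟩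
    funext l
    obtain rfl | hl := eq_or_ne l i <;> simp_all

theorem polyInvPow_add_single [Fintype ι] {a : ∀ i, FreeMonoid (A i) → ℝ} {i : ι}
    (ha : a i 1 = 0) (r : ι → ℕ) (β : ∀ i, FreeMonoid (A i)) :
    polyInvPow a (r + Pi.single i 1) β = polyInvPow a r β +
      ∑ q ∈ leftSplits i β, a i q.1 * polyInvPow a (r + Pi.single i 1) q.2 := by
  have hprod (s : ι → ℕ) (γ : ∀ i, FreeMonoid (A i)) : polyInvPow a s γ =
      invPowCoeff (a i) (s i) (γ i) * ∏ l ∈ Finset.univ.erase i, invPowCoeff (a l) (s l) (γ l) :=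
    (Finset.mul_prod_erase _ _ (Finset.mem_univ i)).symm
  have hoff (γ δ : ∀ i, FreeMonoid (A i)) (h : ∀ l ≠ i, δ l = γ l) :
      ∏ l ∈ Finset.univ.erase i, invPowCoeff (a l) ((r + Pi.single i 1 : ι → ℕ) l) (δ l) =
        ∏ l ∈ Finset.univ.erase i, invPowCoeff (a l) (r l) (γ l) := by
    refine Finset.prod_congr rfl fun l hl => ?_
    have hli := Finset.ne_of_mem_erase hl
    rw [Pi.add_apply, Pi.single_eq_of_ne hli, add_zero, h l hli]
  rw [leftSplits, Finset.sum_map, hprod, hprod r, hoff β β fun _ _ => rfl, Pi.add_apply,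
    Pi.single_eq_same, invPowCoeff_succ ha, add_mul, Finset.sum_mul]
  congr 1
  refine Finset.sum_congr rfl fun p _ => ?_
  rw [Function.Embedding.coeFn_mk, Prod.map_fst, Prod.map_snd, id, hprod,
    hoff β _ fun l hl => Function.update_of_ne hl _ _, Function.update_self, Pi.add_apply,
    Pi.single_eq_same, mul_assoc]

theorem tsum_smul_tsum_mulSingle_mul {E : Type*} [NormedAddCommGroup E] [NormedSpace ℝ E]
    {i : ι} (a : FreeMonoid (A i) → ℝ) (c : (∀ i, FreeMonoid (A i)) → ℝ)
    {G : (∀ i, FreeMonoid (A i)) → E} (hG : (Function.support G).Finite) :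
    ∑' α, a α • ∑' β, c β • G (Pi.mulSingle i α * β) =
      ∑' β, (∑ q ∈ leftSplits i β, a q.1 * c q.2) • G β := by
  let F (q : FreeMonoid (A i) × ∀ i, FreeMonoid (A i)) : E :=
    (a q.1 * c q.2) • G (Pi.mulSingle i q.1 * q.2)
  have hfin : (Function.support F).Finite := (hG.biUnion fun β _ =>
    (leftSplits i β).finite_toSet).subset fun q hq =>
      Set.mem_biUnion (right_ne_zero_of_smul hq) (mem_leftSplits.2 rfl)
  have hsum {τ : Type _} {u : τ → FreeMonoid (A i) × ∀ i, FreeMonoid (A i)}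
      (hu : Function.Injective u) : Summable fun t => F (u t) :=
    summable_of_hasFiniteSupport (hfin.preimage hu.injOn)
  let e := Equiv.sigmaFiberEquiv fun q : FreeMonoid (A i) × ∀ i, FreeMonoid (A i) =>
    Pi.mulSingle i q.1 * q.2
  have hfiber (β : ∀ i, FreeMonoid (A i)) :
      ∑' q, F (e ⟨β, q⟩) = (∑ q ∈ leftSplits i β, a q.1 * c q.2) • G β := by
    have hset : {q : FreeMonoid (A i) × ∀ i, FreeMonoid (A i) | Pi.mulSingle i q.1 * q.2 = β} =
        leftSplits i β := Set.ext fun q => mem_leftSplits.symm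
    refine (tsum_congr_set_coe F hset).trans ((Finset.tsum_subtype' _ F).trans ?_)
    rw [Finset.sum_smul]
    exact Finset.sum_congr rfl fun q hq => by rw [← mem_leftSplits.1 hq]
  calc ∑' α, a α • ∑' β, c β • G (Pi.mulSingle i α * β) = ∑' α, ∑' β, F (α, β) := by
        simp only [F, mul_smul, tsum_const_smul'']
    _ = ∑' q, F q :=
        ((hsum Function.injective_id).tsum_prod' fun α => hsum (Prod.mk_right_injective α)).symm
    _ = ∑' p, F (e p) := (e.tsum_eq F).symm
    _ = ∑' β, ∑' q, F (e ⟨β, q⟩) :=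
        (hsum e.injective).tsum_sigma' fun β => hsum (e.injective.comp sigma_mk_injective)
    _ = ∑' β, (∑ q ∈ leftSplits i β, a q.1 * c q.2) • G β := tsum_congr hfiber

end TupleCoefficients

/-! ### Expansions of operators along the words -/

section Orbit

variable {S K : Type*} [Monoid S] [NormedAddCommGroup K] [InnerProductSpace ℂ K] [CompleteSpace K]
  {W : S →* (K →L[ℂ] K)} {x : K}

theorem adjoint_map_mul_apply (W : S →* (K →L[ℂ] K)) (β γ : S) (x : K) :
    (W (β * γ))† x = (W γ)† ((W β)† x) := by
  rw [map_mul, ContinuousLinearMap.mul_def, ContinuousLinearMap.adjoint_comp]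
  rfl

theorem adjoint_map_one_apply (W : S →* (K →L[ℂ] K)) (x : K) : (W 1)† x = x := by
  rw [map_one, ← ContinuousLinearMap.star_eq_adjoint, star_one, one_apply_eq_self]

variable (W) in
/-- Only finitely many of the operators `(W β)†` do not annihilate `x`. On such vectors all sums
along the words are finite. -/
def HasFiniteOrbit (x : K) : Prop :=
  {β | (W β)† x ≠ 0}.Finite

theorem HasFiniteOrbit.finite_support (hx : HasFiniteOrbit W x) {τ E : Type*} [Zero E] {u : τ → S}
    (hu : Function.Injective u) {Q : K → E} (hQ : Q 0 = 0) :
    (Function.support fun t => Q ((W (u t))† x)).Finite :=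
  (hx.preimage hu.injOn).subset fun t ht (h0 : (W (u t))† x = 0) =>
    ht ((congrArg Q h0).trans hQ)

theorem HasFiniteOrbit.summable (hx : HasFiniteOrbit W x) {τ E : Type*} [NormedAddCommGroup E]
    [NormedSpace ℝ E] {u : τ → S} (hu : Function.Injective u) {Q : K → E} (hQ : Q 0 = 0)
    (c : τ → ℝ) :
    Summable fun t => c t • Q ((W (u t))† x) :=
  summable_of_hasFiniteSupport ((hx.finite_support hu hQ).subset
    fun _ ht => right_ne_zero_of_smul ht)

theorem HasFiniteOrbit.adjoint [IsLeftCancelMul S] (hx : HasFiniteOrbit W x) (β : S) :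
    HasFiniteOrbit W ((W β)† x) :=
  (hx.preimage (mul_right_injective β).injOn).subset fun γ hγ => by
    rwa [Set.mem_preimage, Set.mem_ofPred_eq, adjoint_map_mul_apply]

theorem HasFiniteOrbit.eq_zero_of_eq_tsum [IsLeftCancelMul S] (hx : HasFiniteOrbit W x)
    {τ : Type*} {u : τ → S} {a : τ → ℝ} (ha : ∀ t β, u t * β = 1 → a t = 0)
    {Q : K → ℂ} (hQ : Q 0 = 0)
    (h : ∀ y, HasFiniteOrbit W y → Q y = ∑' t, a t • Q ((W (u t))† y)) : Q x = 0 := by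
  induction hd : {β | (W β)† x ≠ 0}.ncard using Nat.strong_induction_on generalizing x with
  | _ d ih =>
    obtain rfl | hx0 := eq_or_ne x 0
    · exact hQ
    rw [h x hx]
    refine (tsum_congr fun t => ?_).trans tsum_zero
    by_cases hat : a t = 0
    · rw [hat, zero_smul]
    -- the orbit of `(W (u t))† x` embeds into that of `x` by `β ↦ u t * β`, which omits `1`
    have hlt : {β | (W β)† ((W (u t))† x) ≠ 0}.ncard < d := by
      rw [← hd, ← Set.ncard_image_of_injective _ (mul_right_injective (u t))]
      refine Set.ncard_lt_ncard ((Set.ssubset_iff_of_subset ?_).2 ⟨1, ?_, ?_⟩) hx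
      · rintro _ ⟨β, hβ, rfl⟩
        rwa [Set.mem_ofPred_eq, adjoint_map_mul_apply]
      · rwa [Set.mem_ofPred_eq, adjoint_map_one_apply]
      · rintro ⟨β, -, hβ⟩
        exact hat (ha t β hβ)
    rw [ih _ hlt (hx.adjoint (u t)) rfl, smul_zero]

variable (W) in
/-- The sum `∑ β, c β * Q ((W β)† x)`; for a quadratic form `Q x = ⟪x, D x⟫` this is the form of
`∑ β, c β * W_β D W_β†`. -/
def orbitSum (c : S → ℝ) (Q : K → ℂ) (x : K) : ℂ :=
  ∑' β, c β • Q ((W β)† x)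

theorem orbitSum_zero_right (c : S → ℝ) {Q : K → ℂ} (hQ : Q 0 = 0) : orbitSum W c Q 0 = 0 := by
  simp [orbitSum, hQ]

end Orbit

section TupleOrbit

variable {ι K : Type*} {A : ι → Type*} [DecidableEq ι] [Fintype ι]
  [NormedAddCommGroup K] [InnerProductSpace ℂ K] [CompleteSpace K]

theorem HasFiniteOrbit.orbitSum_add_single {W : (∀ i, FreeMonoid (A i)) →* (K →L[ℂ] K)} {x : K}
    (hx : HasFiniteOrbit W x) {Q : K → ℂ} (hQ : Q 0 = 0) {a : ∀ i, FreeMonoid (A i) → ℝ} {i : ι}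
    (ha : a i 1 = 0) (r : ι → ℕ) :
    orbitSum W (polyInvPow a (r + Pi.single i 1)) Q x = orbitSum W (polyInvPow a r) Q x +
      ∑' α, a i α • orbitSum W (polyInvPow a (r + Pi.single i 1)) Q
        ((W (Pi.mulSingle i α))† x) := by
  have hfin := hx.finite_support Function.injective_id hQ
  have hsum := hx.summable Function.injective_id hQ
  simp only [orbitSum, ← adjoint_map_mul_apply, id] at *
  rw [tsum_smul_tsum_mulSingle_mul _ _ hfin, ← (hsum _).tsum_add (hsum _)]
  exact tsum_congr fun β => by rw [← add_smul, polyInvPow_add_single ha]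

end TupleOrbit

section Expansion

variable {K : Type*} [NormedAddCommGroup K] [InnerProductSpace ℂ K]
  {k : ℕ} {n : Fin k → ℕ} {f : ∀ i, PositiveRegular (n i)}
  {W : (∀ i, FreeMonoid (Fin (n i))) →* (K →L[ℂ] K)} {D : K →L[ℂ] K} {r p : Fin k → ℕ}
  {Y Z : K →L[ℂ] K}

variable (W) in
/-- The tuple of operators which determines the representation `W`. -/
def generators (i : Fin k) (j : Fin (n i)) : K →L[ℂ] K :=
  W (Pi.mulSingle i (FreeMonoid.of j))

theorem lift_generators (i : Fin k) (α : FreeMonoid (Fin (n i))) :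
    FreeMonoid.lift (generators W i) α = W (Pi.mulSingle i α) :=
  DFunLike.congr_fun (FreeMonoid.lift_restrict
    (W.comp (MonoidHom.mulSingle (fun i => FreeMonoid (Fin (n i))) i))) α

variable [CompleteSpace K]

variable (f W D r Z) in
/-- On vectors with finite orbit, `Z` has the quadratic form of `∑ β, c β * W_β D W_β†`, where
`c` are the coefficients of `∏ i, (1 - f_i)^{-r_i}`. Formally, `Z` is obtained from `D` by inverting
the defect map of order `r`. -/
def HasExpansion : Prop :=
  ∀ x, HasFiniteOrbit W x →
    ⟪x, Z x⟫_ℂ = orbitSum W (polyInvPow (fun i => (f i).coeff) r) (fun y => ⟪y, D y⟫_ℂ) x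

theorem HasExpansion.self : HasExpansion f W D 0 D := fun x _ => by
  rw [orbitSum, tsum_eq_single 1 fun β hβ => by
    rw [polyInvPow_zero (fun i => (f i).coeff_one) hβ, zero_smul], polyInvPow_one, one_smul,
    adjoint_map_one_apply]

theorem inner_sub_phi_apply {i : Fin k} (h : IsRowContraction (f i) (generators W i))
    (Z : K →L[ℂ] K) (x : K) : ⟪x, (Z - phi (f i) (generators W i) Z) x⟫_ℂ = ⟪x, Z x⟫_ℂ -
      ∑' α, (f i).coeff α • ⟪(W (Pi.mulSingle i α))† x, Z ((W (Pi.mulSingle i α))† x)⟫_ℂ := by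
  simp only [sub_apply, inner_sub_right, ← (h.hasSum_inner_phi Z x x).tsum_eq, lift_generators,
    Complex.real_smul]

theorem hasExpansion_sub_phi_iff {i : Fin k} (h : IsRowContraction (f i) (generators W i)) :
    HasExpansion f W D r (Z - phi (f i) (generators W i) Z) ↔
      HasExpansion f W D (r + Pi.single i 1) Z := by
  let Q (y : K) : ℂ := ⟪y, D y⟫_ℂ
  have hQ : Q 0 = 0 := inner_zero_left _
  let R := orbitSum W (polyInvPow (fun i => (f i).coeff) (r + Pi.single i 1)) Q
  have hR {x : K} (hx : HasFiniteOrbit W x) :=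
    hx.orbitSum_add_single hQ (a := fun i => (f i).coeff) (f i).coeff_one r
  constructor
  · intro hZ x hx
    have hdiff (y : K) (hy : HasFiniteOrbit W y) : ⟪y, Z y⟫_ℂ - R y =
        ∑' α, (f i).coeff α • (⟪(W (Pi.mulSingle i α))† y, Z ((W (Pi.mulSingle i α))† y)⟫_ℂ -
          R ((W (Pi.mulSingle i α))† y)) := by
      have hinj := Pi.mulSingle_injective (M := fun i => FreeMonoid (Fin (n i))) i
      simp only [smul_sub]
      rw [(hy.summable (Q := fun y => ⟪y, Z y⟫_ℂ) hinj (inner_zero_left _) _).tsum_sub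
        (hy.summable hinj (orbitSum_zero_right _ hQ) _), ← sub_eq_sub_iff_sub_eq_sub,
        ← inner_sub_phi_apply h, hZ y hy, sub_eq_iff_eq_add.2 (hR hy)]
    refine sub_eq_zero.1 (hx.eq_zero_of_eq_tsum (Q := fun y => ⟪y, Z y⟫_ℂ - R y) (fun α β hβ => ?_)
      (sub_eq_zero.2 ((inner_zero_left _).trans (orbitSum_zero_right _ hQ).symm)) hdiff)
    have hα : α * β i = 1 := by simpa using congrFun hβ i
    have hα1 : α = 1 := (List.append_eq_nil_iff.1 hα).1
    rw [hα1, (f i).coeff_one]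
  · intro hZ x hx
    rw [inner_sub_phi_apply h, tsum_congr fun α => congrArg ((f i).coeff α • ·)
      (hZ _ (hx.adjoint (Pi.mulSingle i α))), hZ x hx, hR hx, add_sub_cancel_right]

theorem hasExpansion_iterate_sub_phi_iff {i : Fin k} (h : IsRowContraction (f i) (generators W i))
    (q : ℕ) : HasExpansion f W D r ((fun Z => Z - phi (f i) (generators W i) Z)^[q] Z) ↔
      HasExpansion f W D (r + Pi.single i q) Z := by
  induction q generalizing r with
  | zero => rw [Pi.single_zero, add_zero]; rfl
  | succ q ih =>
    rw [Function.iterate_succ_apply', hasExpansion_sub_phi_iff h, ih, add_assoc, ← Pi.single_add,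
      add_comm 1 q]

theorem hasExpansion_defect_iff (h : ∀ i, IsRowContraction (f i) (generators W i)) :
    HasExpansion f W D r (defect f (generators W) p Y) ↔ HasExpansion f W D (r + p) Y := by
  have halong (l : List (Fin k)) : ∀ {r},
      HasExpansion f W D r (defectAlong f (generators W) p l Y) ↔
      HasExpansion f W D (r + (l.map fun i => Pi.single i (p i)).sum) Y := by
    induction l with
    | nil => intro r; rw [List.map_nil, List.sum_nil, add_zero]; rfl
    | cons i l ih =>
      intro r
      rw [defectAlong_cons, hasExpansion_iterate_sub_phi_iff (h i), ih, List.map_cons,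
        List.sum_cons, add_assoc]
  rw [defect_eq_defectAlong, halong, ← Fin.sum_univ_def, Finset.univ_sum_single]

theorem hasExpansion_defect (h : ∀ i, IsRowContraction (f i) (generators W i)) (p : Fin k → ℕ)
    (Y : K →L[ℂ] K) : HasExpansion f W (defect f (generators W) p Y) p Y := by
  have hY := (hasExpansion_defect_iff (p := p) (Y := Y) h).1 HasExpansion.self
  rwa [zero_add] at hY

theorem orbitSum_polyInvPow_nonneg (hD : D.IsPositive) (r : Fin k → ℕ) (x : K) :
    0 ≤ orbitSum W (polyInvPow (fun i => (f i).coeff) r) (fun y => ⟪y, D y⟫_ℂ) x :=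
  tsum_nonneg fun β => by
    rw [Complex.real_smul]
    exact mul_nonneg (Complex.zero_le_real.2 (polyInvPow_nonneg (fun i => (f i).coeff_nonneg) r β))
      (hD.inner_nonneg_right _)

theorem HasExpansion.isPositive (hW : Dense {x | HasFiniteOrbit W x}) (hD : D.IsPositive)
    (hZ : HasExpansion f W D r Z) : Z.IsPositive :=
  isPositive_of_dense hW fun x hx => by
    rw [hZ x hx]
    exact orbitSum_polyInvPow_nonneg hD r x

theorem HasExpansion.isRowContraction (hW : Dense {x | HasFiniteOrbit W x}) (hD : D.IsPositive)
    {i : Fin k} (h : HasExpansion f W D (r + Pi.single i 1) 1) :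
    IsRowContraction (f i) (generators W i) := by
  intro s x
  refine hW.induction (P := fun x => ∑ α ∈ s, (f i).coeff α *
    ‖(FreeMonoid.lift (generators W i) α)† x‖ ^ 2 ≤ ‖x‖ ^ 2) (fun x hx => ?_)
    (isClosed_le (by fun_prop) (by fun_prop)) x
  have hone (y : K) : ⟪y, (1 : K →L[ℂ] K) y⟫_ℂ = ((‖y‖ ^ 2 : ℝ) : ℂ) := by
    rw [one_apply_eq_self, inner_self_eq_norm_sq_to_K]
    exact (Complex.ofReal_pow _ _).symm
  have hexp : ((‖x‖ ^ 2 : ℝ) : ℂ) =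
      orbitSum W (polyInvPow (fun i => (f i).coeff) r) (fun y => ⟪y, D y⟫_ℂ) x +
        ((∑' α, (f i).coeff α * ‖(W (Pi.mulSingle i α))† x‖ ^ 2 : ℝ) : ℂ) := by
    rw [← hone, h x hx, hx.orbitSum_add_single (Q := fun y => ⟪y, D y⟫_ℂ)
      (inner_zero_left _) (a := fun i => (f i).coeff) (f i).coeff_one, Complex.ofReal_tsum]
    congr 1
    exact tsum_congr fun α => by
      rw [← h _ (hx.adjoint (Pi.mulSingle i α)), hone, Complex.real_smul, ← Complex.ofReal_mul]
  have hsum := hx.summable (Pi.mulSingle_injective (M := fun i => FreeMonoid (Fin (n i))) i)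
    (Q := fun y => ‖y‖ ^ 2) (by simp) (f i).coeff
  simp only [lift_generators]
  calc _ ≤ ∑' α, (f i).coeff α * ‖(W (Pi.mulSingle i α))† x‖ ^ 2 :=
        hsum.sum_le_tsum s fun α _ => mul_nonneg ((f i).coeff_nonneg α) (sq_nonneg _)
    _ ≤ ‖x‖ ^ 2 := Complex.real_le_real.1
        (hexp ▸ le_add_of_nonneg_left (orbitSum_polyInvPow_nonneg hD r x))

theorem HasExpansion.exists_eq_adjoint_comp_self {H : Type*} [NormedAddCommGroup H]
    [InnerProductSpace ℂ H] [CompleteSpace H] (hW : Dense {x | HasFiniteOrbit W x})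
    {C : K →L[ℂ] H} (hY : HasExpansion f W (C† ∘L C) r Y) :
    ∃ B : K →L[ℂ] lp (fun _ : ∀ i, FreeMonoid (Fin (n i)) => H) 2, B† ∘L B = Y ∧ ∀ x β,
      B x β = ((√(polyInvPow (fun i => (f i).coeff) r β) : ℝ) : ℂ) • C ((W β)† x) := by
  refine exists_adjoint_comp_column_eq hW (T := fun β =>
    ((√(polyInvPow (fun i => (f i).coeff) r β) : ℝ) : ℂ) • (C ∘L (W β)†)) fun x hx => ?_
  have hterm (β : ∀ i, FreeMonoid (Fin (n i))) :
      ((‖((√(polyInvPow (fun i => (f i).coeff) r β) : ℝ) : ℂ) • C ((W β)† x)‖ ^ 2 : ℝ) : ℂ) =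
        polyInvPow (fun i => (f i).coeff) r β • ⟪(W β)† x, (C† ∘L C) ((W β)† x)⟫_ℂ := by
    rw [norm_sqrt_smul_sq (polyInvPow_nonneg (fun i => (f i).coeff_nonneg) r β),
      ContinuousLinearMap.comp_apply, ContinuousLinearMap.adjoint_inner_right,
      inner_self_eq_norm_sq_to_K, Complex.real_smul, Complex.ofReal_mul, Complex.ofReal_pow]
    rfl
  simp only [smul_apply, ContinuousLinearMap.comp_apply, hterm]
  rw [hY x hx, orbitSum]
  exact (hx.summable Function.injective_id (Q := fun y => ⟪y, (C† ∘L C) y⟫_ℂ)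
    (inner_zero_left _) _).hasSum

end Expansion

/-! ### The model operators as a weighted shift representation -/

section ShiftAdjoint

variable {ι : Type v} {H : Type u} [NormedAddCommGroup H]

open scoped Classical in
theorem dense_finite_support :
    Dense {x : lp (fun _ : ι => H) 2 | (Function.support (x : ι → H)).Finite} := by
  intro x
  refine mem_closure_of_tendsto (lp.hasSum_single (p := 2) (by norm_num) x)
    (Eventually.of_forall fun s => s.finite_toSet.subset fun b hb => ?_)
  by_contra hbs
  refine hb ?_
  rw [lp.coeFn_sum, Finset.sum_apply]
  exact Finset.sum_eq_zero fun a ha => lp.single_apply_ne _ _ _ fun h => hbs (h ▸ ha)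

variable [InnerProductSpace ℂ H]

open scoped Classical in
theorem weightedShift_single {σ : ι → ι} (hσ : Function.Injective σ) (w : ι → ℝ) (C : ℝ)
    (hC : ∀ a, |w a| ≤ C) (a : ι) (h : H) :
    weightedShift σ hσ w C hC (lp.single 2 a h) = lp.single 2 (σ a) ((w a : ℂ) • h) := by
  ext b
  by_cases hb : b ∈ Set.range σ
  · obtain ⟨c, rfl⟩ := hb
    rw [weightedShift_apply]
    obtain rfl | hc := eq_or_ne c a
    · rw [lp.single_apply_self, lp.single_apply_self]
    · rw [lp.single_apply_ne _ _ _ hc, lp.single_apply_ne _ _ _ (hσ.ne hc), smul_zero]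
  · rw [weightedShift_apply_of_notMem _ _ _ _ _ _ hb,
      lp.single_apply_ne _ _ _ fun h => hb ⟨a, h.symm⟩]

open scoped Classical in
theorem adjoint_weightedShift_apply [CompleteSpace H] {σ : ι → ι} (hσ : Function.Injective σ)
    (w : ι → ℝ) (C : ℝ) (hC : ∀ a, |w a| ≤ C) (x : lp (fun _ : ι => H) 2) (a : ι) :
    (weightedShift σ hσ w C hC)† x a = (w a : ℂ) • x (σ a) := by
  refine ext_inner_left ℂ fun h => ?_
  refine (lp.inner_single_left (𝕜 := ℂ) (G := fun _ : ι => H) a h _).symm.trans ?_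
  rw [ContinuousLinearMap.adjoint_inner_right, weightedShift_single, lp.inner_single_left,
    inner_smul_left, inner_smul_right, Complex.conj_ofReal]

end ShiftAdjoint

section ShiftRep

variable {S : Type v} [Monoid S] {b : S → ℝ}

/-- Positive weights `b` on a monoid for which the shifts
`e_γ ↦ (√b_γ / √b_{βγ}) e_{βγ}` are bounded. -/
structure IsShiftWeight (b : S → ℝ) : Prop where
  pos : ∀ β, 0 < b β
  exists_mul_le : ∀ β, ∃ c, 0 < c ∧ ∀ γ, c * b γ ≤ b (β * γ)

theorem IsShiftWeight.exists_abs_le (hb : IsShiftWeight b) (β : S) :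
    ∃ C, ∀ γ, |√(b γ) / √(b (β * γ))| ≤ C := by
  obtain ⟨c, hc, hle⟩ := hb.exists_mul_le β
  refine ⟨1 / √c, fun γ => ?_⟩
  have hβγ := hb.pos (β * γ)
  rw [abs_of_nonneg (by positivity), div_le_div_iff₀ (by positivity) (by positivity), one_mul,
    ← Real.sqrt_mul (hb.pos γ).le, mul_comm]
  exact Real.sqrt_le_sqrt (hle γ)

variable [IsLeftCancelMul S] (H : Type u) [NormedAddCommGroup H] [InnerProductSpace ℂ H]
  [CompleteSpace H]

/-- The representation of `S` by the weighted shifts `e_γ ⊗ h ↦ (√b_γ / √b_{βγ}) e_{βγ} ⊗ h`. -/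
def shiftRep (hb : IsShiftWeight b) :
    S →* (lp (fun _ : S => H) 2 →L[ℂ] lp (fun _ : S => H) 2) where
  toFun β := weightedShift (β * ·) (mul_right_injective β) (fun γ => √(b γ) / √(b (β * γ)))
    (hb.exists_abs_le β).choose (hb.exists_abs_le β).choose_spec
  map_one' := by
    apply ContinuousLinearMap.adjoint.injective
    ext x γ
    have hγ := hb.pos γ
    rw [adjoint_weightedShift_apply, one_mul, div_self (by positivity), Complex.ofReal_one,
      one_smul, ContinuousLinearMap.one_def, ContinuousLinearMap.adjoint_id]
    rfl
  map_mul' β γ := by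
    apply ContinuousLinearMap.adjoint.injective
    rw [ContinuousLinearMap.mul_def, ContinuousLinearMap.adjoint_comp]
    ext x δ
    have hγδ := hb.pos (γ * δ)
    rw [ContinuousLinearMap.comp_apply]
    simp only [adjoint_weightedShift_apply, smul_smul, ← Complex.ofReal_mul, mul_assoc]
    rw [div_mul_div_cancel₀ (by positivity)]

variable {H}

theorem adjoint_shiftRep_apply (hb : IsShiftWeight b) (β γ : S) (x : lp (fun _ : S => H) 2) :
    (shiftRep H hb β)† x γ = ((√(b γ) / √(b (β * γ)) : ℝ) : ℂ) • x (β * γ) :=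
  adjoint_weightedShift_apply (mul_right_injective β) _ _
    (hb.exists_abs_le β).choose_spec x γ

theorem mul_norm_sq_adjoint_shiftRep_apply_one (hb : IsShiftWeight b) (hb1 : b 1 = 1) (β : S)
    (x : lp (fun _ : S => H) 2) : b β * ‖(shiftRep H hb β)† x 1‖ ^ 2 = ‖x β‖ ^ 2 := by
  have hβ := hb.pos β
  rw [adjoint_shiftRep_apply, mul_one, hb1, Real.sqrt_one, norm_smul, Complex.norm_real,
    Real.norm_of_nonneg (by positivity), mul_pow, div_pow, one_pow, Real.sq_sqrt hβ.le,
    one_div, mul_inv_cancel_left₀ hβ.ne']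

theorem dense_hasFiniteOrbit_shiftRep (hb : IsShiftWeight b) (hS : ∀ δ : S, {β | β ∣ δ}.Finite) :
    Dense {x | HasFiniteOrbit (shiftRep H hb) x} := by
  refine dense_finite_support.mono fun x hx => ?_
  have hsupport : (Function.support (x : S → H)).Finite := hx
  refine (hsupport.biUnion fun δ _ => hS δ).subset fun β hβ => ?_
  by_contra hnot
  refine hβ (lp.ext (funext fun γ => ?_))
  have hzero : x (β * γ) = 0 := by
    by_contra hne
    exact hnot (Set.mem_biUnion (x := β * γ) hne (dvd_mul_right β γ))
  rw [adjoint_shiftRep_apply, hzero, smul_zero]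
  rfl

end ShiftRep

theorem exists_eq_adjoint_comp_self_of_isPositive {K : Type*} [NormedAddCommGroup K]
    [InnerProductSpace ℂ K] [CompleteSpace K] {Z : K →L[ℂ] K} (hZ : Z.IsPositive) :
    ∃ C : K →L[ℂ] K, Z = C† ∘L C :=
  CStarAlgebra.nonneg_iff_eq_star_mul_self.1 ((ContinuousLinearMap.nonneg_iff_isPositive Z).2 hZ)

section ModelRep

variable {k : ℕ} {n : Fin k → ℕ} (f : ∀ i, PositiveRegular (n i)) (m : Fin k → ℕ)

/-- The weights `b_{1,β_1} ⋯ b_{k,β_k}` of the universal model. -/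
def modelWeight (β : ∀ i, FreeMonoid (Fin (n i))) : ℝ :=
  ∏ i, bCoeff (f i).coeff (m i) (β i)

theorem modelWeight_one : modelWeight f m 1 = 1 :=
  Finset.prod_eq_one fun i _ => bCoeff_one (f i).coeff (m i)

theorem polyInvPow_eq_modelWeight {m : Fin k → ℕ} (hm : ∀ i, 1 ≤ m i) :
    polyInvPow (fun i => (f i).coeff) m = modelWeight f m :=
  funext fun _ => Finset.prod_congr rfl fun i _ => invPowCoeff_eq_bCoeff _ (hm i) _

theorem exists_mul_bCoeff_le {N : ℕ} (g : PositiveRegular N) (q : ℕ) (α : FreeMonoid (Fin N)) :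
    ∃ c, 0 < c ∧ ∀ γ, c * bCoeff g.coeff q γ ≤ bCoeff g.coeff q (α * γ) := by
  induction α using FreeMonoid.inductionOn' with
  | one => exact ⟨1, one_pos, fun γ => by rw [one_mul, one_mul]⟩
  | of_mul j α ih =>
    obtain ⟨c, hc, hle⟩ := ih
    refine ⟨g.coeff (FreeMonoid.of j) * c, mul_pos (g.coeff_of_pos j) hc, fun γ => ?_⟩
    rw [mul_assoc, mul_assoc]
    exact (mul_le_mul_of_nonneg_left (hle γ) (g.coeff_nonneg _)).trans (bCoeff_of_mul g q j _)

theorem isShiftWeight_modelWeight : IsShiftWeight (modelWeight f m) where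
  pos _ := Finset.prod_pos fun i _ => bCoeff_pos (f i) (m i) _
  exists_mul_le β := by
    choose c hc hle using fun i => exists_mul_bCoeff_le (f i) (m i) (β i)
    refine ⟨∏ i, c i, Finset.prod_pos fun i _ => hc i, fun γ => ?_⟩
    rw [modelWeight, ← Finset.prod_mul_distrib]
    exact Finset.prod_le_prod (fun i _ => (mul_pos (hc i) (bCoeff_pos _ _ _)).le)
      fun i _ => hle i (γ i)

theorem sqrt_modelWeight_div_sqrt (i : Fin k) (j : Fin (n i)) (γ : ∀ i, FreeMonoid (Fin (n i))) :
    √(modelWeight f m γ) / √(modelWeight f m (Pi.mulSingle i (FreeMonoid.of j) * γ)) =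
      weight (f i) (m i) j (γ i) := by
  have hrest : ∏ l ∈ Finset.univ.erase i, bCoeff (f l).coeff (m l)
        ((Pi.mulSingle i (FreeMonoid.of j) * γ : ∀ i, FreeMonoid (Fin (n i))) l) =
      ∏ l ∈ Finset.univ.erase i, bCoeff (f l).coeff (m l) (γ l) :=
    Finset.prod_congr rfl fun l hl => by
      rw [Pi.mul_apply, Pi.mulSingle_eq_of_ne (Finset.ne_of_mem_erase hl), one_mul]
  have hpos : 0 < ∏ l ∈ Finset.univ.erase i, bCoeff (f l).coeff (m l) (γ l) :=
    Finset.prod_pos fun l _ => bCoeff_pos _ _ _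
  rw [modelWeight, modelWeight, ← Finset.mul_prod_erase _ _ (Finset.mem_univ i),
    ← Finset.mul_prod_erase _ _ (Finset.mem_univ i), hrest, Real.sqrt_mul (bCoeff_pos _ _ _).le,
    Real.sqrt_mul (bCoeff_pos _ _ _).le, mul_div_mul_right _ _ (by positivity), Pi.mul_apply,
    Pi.mulSingle_eq_same, weight]

theorem finite_setOf_dvd (δ : ∀ i, FreeMonoid (Fin (n i))) : {β | β ∣ δ}.Finite := by
  have hword {N : ℕ} (α : FreeMonoid (Fin N)) : {β | β ∣ α}.Finite :=
    ((mulAntidiagonal α).finite_toSet.image Prod.fst).subset fun β ⟨γ, hγ⟩ =>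
      ⟨(β, γ), Finset.mem_coe.2 (mem_mulAntidiagonal.2 hγ.symm), rfl⟩
  exact (Set.Finite.pi' fun i => hword (δ i)).subset fun _ ⟨γ, hγ⟩ i => ⟨γ i, congrFun hγ i⟩

variable (H : Type u) [NormedAddCommGroup H] [InnerProductSpace ℂ H] [CompleteSpace H]

/-- The operators `𝐖_{1,β_1} ⋯ 𝐖_{k,β_k} ⊗ I_H`, as a representation of the tuples of words. -/
def modelRep : (∀ i, FreeMonoid (Fin (n i))) →* (PolyFock n H →L[ℂ] PolyFock n H) :=
  shiftRep H (isShiftWeight_modelWeight f m)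

variable {H} in
theorem adjoint_modelRep_apply (β γ : ∀ i, FreeMonoid (Fin (n i))) (x : PolyFock n H) :
    (modelRep f m H β)† x γ =
      ((√(modelWeight f m γ) / √(modelWeight f m (β * γ)) : ℝ) : ℂ) • x (β * γ) :=
  adjoint_shiftRep_apply _ β γ x

theorem generators_modelRep : generators (modelRep f m H) = model f m H := by
  funext i j
  apply ContinuousLinearMap.adjoint.injective
  ext x γ
  have hγ : Pi.mulSingle i (FreeMonoid.of j) * γ = leftMul i j γ := by
    rw [leftMul, eq_comm, Function.update_eq_iff]
    refine ⟨by rw [Pi.mul_apply, Pi.mulSingle_eq_same], fun l hl => ?_⟩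
    rw [Pi.mul_apply, Pi.mulSingle_eq_of_ne hl, one_mul]
  rw [generators, adjoint_modelRep_apply, sqrt_modelWeight_div_sqrt, hγ]
  exact (adjoint_weightedShift_apply (leftMul_injective i j)
    (fun α => weight (f i) (m i) j (α i)) _ (fun α => abs_weight_le (f i) (m i) j (α i)) x γ).symm

theorem dense_hasFiniteOrbit_modelRep : Dense {x | HasFiniteOrbit (modelRep f m H) x} :=
  dense_hasFiniteOrbit_shiftRep _ finite_setOf_dvd

variable {f m H}

variable (n H) in
/-- The evaluation of a family at the empty words. Its square `vacuum† ∘L vacuum` is the projection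
onto `e_1 ⊗ ⋯ ⊗ e_1 ⊗ H`. -/
def vacuum : PolyFock n H →L[ℂ] H :=
  lp.evalCLM ℂ (fun _ => H) 2 1

theorem hasExpansion_one_modelRep (hm : ∀ i, 1 ≤ m i) :
    HasExpansion f (modelRep f m H) ((vacuum n H)† ∘L vacuum n H) m 1 := by
  intro x _
  have hterm (β : ∀ i, FreeMonoid (Fin (n i))) : ((‖x β‖ ^ 2 : ℝ) : ℂ) =
      polyInvPow (fun i => (f i).coeff) m β • ⟪(modelRep f m H β)† x,
        ((vacuum n H)† ∘L vacuum n H) ((modelRep f m H β)† x)⟫_ℂ := by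
    rw [polyInvPow_eq_modelWeight f hm, ContinuousLinearMap.comp_apply,
      ContinuousLinearMap.adjoint_inner_right, inner_self_eq_norm_sq_to_K, Complex.real_smul,
      ← mul_norm_sq_adjoint_shiftRep_apply_one (isShiftWeight_modelWeight f m)
        (modelWeight_one f m), Complex.ofReal_mul, Complex.ofReal_pow]
    rfl
  rw [orbitSum, ← tsum_congr hterm, ← Complex.ofReal_tsum, ← norm_sq_eq, one_apply_eq_self,
    inner_self_eq_norm_sq_to_K]
  exact (Complex.ofReal_pow _ _).symm

theorem isRowContraction_model (hm : ∀ i, 1 ≤ m i) (i : Fin k) :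
    IsRowContraction (f i) (model f m H i) := by
  rw [← generators_modelRep]
  refine HasExpansion.isRowContraction (r := m - Pi.single i 1)
    (dense_hasFiniteOrbit_modelRep f m H)
    (ContinuousLinearMap.isPositive_adjoint_comp_self (vacuum n H)) ?_
  have hi : Pi.single i 1 ≤ m := update_le_iff.2 ⟨hm i, fun _ _ => Nat.zero_le _⟩
  rw [tsub_add_cancel_of_le hi]
  exact hasExpansion_one_modelRep hm

theorem isPositive_defect_model_one (hm : ∀ i, 1 ≤ m i) {p : Fin k → ℕ} (hp : p ≤ m) :
    (defect f (model f m H) p 1).IsPositive := by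
  have hrow := isRowContraction_model (f := f) (H := H) hm
  rw [← generators_modelRep] at hrow ⊢
  refine HasExpansion.isPositive (f := f) (r := m - p) (dense_hasFiniteOrbit_modelRep f m H)
    (ContinuousLinearMap.isPositive_adjoint_comp_self (vacuum n H)) ?_
  rw [hasExpansion_defect_iff hrow, tsub_add_cancel_of_le hp]
  exact hasExpansion_one_modelRep hm

theorem IsMultiAnalytic.isPositive_defect {E : Type*} [NormedAddCommGroup E]
    [InnerProductSpace ℂ E] [CompleteSpace E] (hm : ∀ i, 1 ≤ m i)
    {A : PolyFock n E →L[ℂ] PolyFock n H} (hA : IsMultiAnalytic f m A) {p : Fin k → ℕ}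
    (hp : p ≤ m) : (defect f (model f m H) p (A ∘L A†)).IsPositive := by
  have hconj := defect_conj (isRowContraction_model (f := f) hm) hA p 1
  rw [ContinuousLinearMap.one_def, ContinuousLinearMap.id_comp] at hconj
  rw [hconj]
  exact (isPositive_defect_model_one hm hp).conj_adjoint A

theorem exists_isMultiAnalytic_comp_adjoint_eq (hm : ∀ i, 1 ≤ m i)
    {Y : PolyFock n H →L[ℂ] PolyFock n H} (hY : (defect f (model f m H) m Y).IsPositive) :
    ∃ A : PolyFock n (PolyFock n H) →L[ℂ] PolyFock n H, IsMultiAnalytic f m A ∧ A ∘L A† = Y := by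
  obtain ⟨C, hC⟩ := exists_eq_adjoint_comp_self_of_isPositive hY
  have hrow := isRowContraction_model (f := f) (H := H) hm
  rw [← generators_modelRep] at hC hrow
  have hexp : HasExpansion f (modelRep f m H) (C† ∘L C) m Y := hC ▸ hasExpansion_defect hrow m Y
  obtain ⟨B, hBY, hB⟩ := hexp.exists_eq_adjoint_comp_self (dense_hasFiniteOrbit_modelRep f m H)
  refine ⟨B†, fun i j => ?_, by rw [ContinuousLinearMap.adjoint_adjoint, hBY]⟩
  apply ContinuousLinearMap.adjoint.injective
  rw [ContinuousLinearMap.adjoint_comp, ContinuousLinearMap.adjoint_comp,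
    ContinuousLinearMap.adjoint_adjoint, ← generators_modelRep, ← generators_modelRep]
  ext x γ
  have hγ := (isShiftWeight_modelWeight f m).pos (Pi.mulSingle i (FreeMonoid.of j) * γ)
  rw [ContinuousLinearMap.comp_apply, ContinuousLinearMap.comp_apply, generators, generators,
    hB, adjoint_modelRep_apply, hB, polyInvPow_eq_modelWeight f hm, smul_smul,
    ← Complex.ofReal_mul, div_mul_cancel₀ _ (by positivity), adjoint_map_mul_apply]

end ModelRep

/-! ### Beurling type subspaces -/

section PartialIsometry

variable {K L : Type*} [NormedAddCommGroup K] [InnerProductSpace ℂ K] [CompleteSpace K]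
  [NormedAddCommGroup L] [InnerProductSpace ℂ L] [CompleteSpace L] {V : K →L[ℂ] L}

theorem adjoint_apply_mem_orthogonal_ker (V : K →L[ℂ] L) (y : L) : V† y ∈ V.kerᗮ := by
  rw [V.orthogonal_ker]
  exact Submodule.le_topologicalClosure _ ⟨y, rfl⟩

theorem isPartialIsometry_iff_adjoint_apply_apply :
    IsPartialIsometry V ↔ ∀ x ∈ V.kerᗮ, V† (V x) = x := by
  refine ⟨fun hV x hx => ?_, fun hV x hx => ?_⟩
  · let T : V.kerᗮ →ₗᵢ[ℂ] L := ⟨(V : K →ₗ[ℂ] L).domRestrict V.kerᗮ, fun z => hV z z.2⟩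
    have hinner {z : K} (hz : z ∈ V.kerᗮ) : ⟪z, V† (V x) - x⟫_ℂ = 0 := by
      rw [inner_sub_right, ContinuousLinearMap.adjoint_inner_right]
      exact sub_eq_zero.2 (T.inner_map_map ⟨z, hz⟩ ⟨x, hx⟩)
    exact sub_eq_zero.1 (inner_self_eq_zero.1 (hinner (Submodule.sub_mem _
      (adjoint_apply_mem_orthogonal_ker V _) hx)))
  · rw [← sq_eq_sq₀ (norm_nonneg _) (norm_nonneg _), V.apply_norm_sq_eq_inner_adjoint_right,
      ContinuousLinearMap.comp_apply, hV x hx, inner_self_eq_norm_sq]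

theorem starProjection_eq_comp_adjoint_iff {M : Submodule ℂ L} [M.HasOrthogonalProjection] :
    M.starProjection = V ∘L V† ↔ IsPartialIsometry V ∧ (M : Set L) = Set.range V := by
  rw [isPartialIsometry_iff_adjoint_apply_apply]
  refine ⟨fun h => ?_, fun ⟨hV, hM⟩ => ContinuousLinearMap.ext fun y => ?_⟩
  · have hker : Mᗮ = V†.ker := by
      rw [← V.ker_self_comp_adjoint, ← h, Submodule.ker_starProjection]
    have hmem (x : K) : V x ∈ M := by
      rw [← M.orthogonal_orthogonal, hker]
      simpa only [ContinuousLinearMap.adjoint_adjoint] using adjoint_apply_mem_orthogonal_ker V† x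
    have hproj (y : L) : M.starProjection y = V (V† y) := DFunLike.congr_fun h y
    refine ⟨fun x hx => ?_, Set.Subset.antisymm (fun y hy => ?_) (Set.range_subset_iff.2 hmem)⟩
    · have hsub : V† (V x) - x ∈ V.ker := by
        rw [LinearMap.mem_ker, ContinuousLinearMap.coe_coe, map_sub, ← hproj,
          Submodule.starProjection_eq_self_iff.2 (hmem x), sub_self]
      exact sub_eq_zero.1 (inner_self_eq_zero.1
        (Submodule.sub_mem _ (adjoint_apply_mem_orthogonal_ker V _) hx _ hsub))
    · exact ⟨V† y, (hproj y).symm.trans (Submodule.starProjection_eq_self_iff.2 hy)⟩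
  · refine Submodule.eq_starProjection_of_mem_orthogonal ?_ fun z hz => ?_
    · rw [← SetLike.mem_coe, hM]
      exact Set.mem_range_self _
    · rw [← SetLike.mem_coe, hM] at hz
      obtain ⟨x, rfl⟩ := hz
      rw [← ContinuousLinearMap.adjoint_inner_right, map_sub, ContinuousLinearMap.comp_apply,
        hV _ (adjoint_apply_mem_orthogonal_ker V y), sub_self, inner_zero_right]

end PartialIsometry

section Beurling

variable {k : ℕ} {n : Fin k → ℕ} {f : ∀ i, PositiveRegular (n i)} {m : Fin k → ℕ}
  {H : Type u} [NormedAddCommGroup H] [InnerProductSpace ℂ H] [CompleteSpace H]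

theorem isBeurlingType_iff (hm : ∀ i, 1 ≤ m i) (M : Submodule ℂ (PolyFock n H))
    [CompleteSpace M] :
    IsBeurlingType f m M ↔ ∀ p : Fin k → ℕ, p ≤ m →
      (defect f (model f m H) p M.starProjection).IsPositive := by
  refine ⟨fun ⟨E, _, _, _, Ψ, ⟨hΨ, hiso⟩, hM⟩ p hp => ?_, fun h => ?_⟩
  · rw [starProjection_eq_comp_adjoint_iff.2 ⟨hiso, hM⟩]
    exact hΨ.isPositive_defect hm hp
  · obtain ⟨Ψ, hΨ, hM⟩ := exists_isMultiAnalytic_comp_adjoint_eq hm (h m le_rfl)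
    obtain ⟨hiso, hrange⟩ := starProjection_eq_comp_adjoint_iff.1 hM.symm
    exact ⟨PolyFock n H, inferInstance, inferInstance, inferInstance, Ψ, ⟨hΨ, hiso⟩, hrange⟩

theorem commute_model {i j : Fin k} (hij : i ≠ j) (p : Fin (n i)) (q : Fin (n j)) :
    Commute (model f m H i p) (model f m H j q) := by
  rw [← generators_modelRep]
  exact (Pi.mulSingle_commute hij _ _).map (modelRep f m H)

theorem DoublyCommuting.isPositive_defect_starProjection (hm : ∀ i, 1 ≤ m i)
    {M : Submodule ℂ (PolyFock n H)} [CompleteSpace M]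
    {hM : ∀ (i : Fin k) (j : Fin (n i)), ∀ x ∈ M, model f m H i j x ∈ M}
    (hT : DoublyCommuting fun i j => restrictTo (model f m H i j) M (hM i j))
    {p : Fin k → ℕ} (hp : p ≤ 1) : (defect f (model f m H) p M.starProjection).IsPositive := by
  have hrow (i : Fin k) : IsRowContraction (f i) fun j => restrictTo (model f m H i j) M (hM i j) :=
    (isRowContraction_model hm i).of_isometry M.subtypeₗᵢ fun _ => rfl
  have hcomm (i j : Fin k) (hij : i ≠ j) (q : Fin (n i)) (r : Fin (n j)) :
      Commute (restrictTo (model f m H i q) M (hM i q)) (restrictTo (model f m H j r) M (hM j r)) :=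
    ContinuousLinearMap.ext fun x =>
      Subtype.ext (DFunLike.congr_fun (commute_model hij q r).eq (x : PolyFock n H))
  have hproj : M.starProjection = M.subtypeL ∘L (1 : M →L[ℂ] M) ∘L M.subtypeL† := by
    rw [M.adjoint_subtypeL]
    rfl
  rw [hproj, defect_conj (A := M.subtypeL) hrow fun _ _ => rfl]
  exact (hT.isPositive_defect_one hcomm hrow hp).conj_adjoint M.subtypeL

end Beurling

end Polydomain

end

theorem mainTheorem6 {k : ℕ} (hk : 1 ≤ k) (n m : Fin k → ℕ) (hn : ∀ i, 1 ≤ n i)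
    (hm : ∀ i, 1 ≤ m i) (f : ∀ i, Polydomain.PositiveRegular (n i))
    (H : Type u) [NormedAddCommGroup H] [InnerProductSpace ℂ H] [CompleteSpace H] :
    -- the series defining the maps `Φ_{f_i, 𝐖_i ⊗ I}` converge in the weak operator topology
    (∀ (i : Fin k) (Y : Polydomain.PolyFock n H →L[ℂ] Polydomain.PolyFock n H),
      Tendsto
        (fun N : ℕ => (ContinuousLinearMapWOT.ofCLM
            (Polydomain.phiPartialSum (f i) (Polydomain.model f m H i) Y N) :
              Polydomain.PolyFock n H →WOT[ℂ] Polydomain.PolyFock n H))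
        atTop
        (𝓝 (ContinuousLinearMapWOT.ofCLM
          (Polydomain.phi (f i) (Polydomain.model f m H i) Y)))) ∧
    -- the factorization theorem
    (∀ Y : Polydomain.PolyFock n H →L[ℂ] Polydomain.PolyFock n H,
      (∃ (E : Type u) (_ : NormedAddCommGroup E) (_ : InnerProductSpace ℂ E)
          (_ : CompleteSpace E) (A : Polydomain.PolyFock n E →L[ℂ] Polydomain.PolyFock n H),
          Polydomain.IsMultiAnalytic f m A ∧ Y = A ∘L ContinuousLinearMap.adjoint A) ↔
        ∀ p : Fin k → ℕ, p ≤ m → p ≠ 0 →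
          (Polydomain.defect f (Polydomain.model f m H) p Y).IsPositive) ∧
    -- closed (equivalently: complete) invariant subspaces
    (∀ (M : Submodule ℂ (Polydomain.PolyFock n H)) [CompleteSpace M]
      (hM : ∀ (i : Fin k) (j : Fin (n i)), ∀ x ∈ M, Polydomain.model f m H i j x ∈ M),
      (Polydomain.IsBeurlingType f m M ↔
        ∀ p : Fin k → ℕ, p ≤ m →
          (Polydomain.defect f (Polydomain.model f m H) p M.starProjection).IsPositive) ∧
      ((∀ i, m i = 1) →
        Polydomain.DoublyCommuting
          (fun i j => Polydomain.restrictTo (Polydomain.model f m H i j) M (hM i j)) →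
        (∀ p : Fin k → ℕ, p ≤ m →
          (Polydomain.defect f (Polydomain.model f m H) p M.starProjection).IsPositive) ∧
        Polydomain.IsBeurlingType f m M)) := by
  have hrow := Polydomain.isRowContraction_model (f := f) (H := H) hm
  refine ⟨fun i Y => (hrow i).tendsto_phiPartialSum Y, fun Y => ⟨?_, fun hpos => ?_⟩,
    fun M _ hM => ⟨Polydomain.isBeurlingType_iff hm M, fun hm1 hT => ?_⟩⟩
  · rintro ⟨E, _, _, _, A, hA, rfl⟩ p hp _
    exact hA.isPositive_defect hm hp
  · have hm0 : m ≠ 0 := fun h => absurd (hm ⟨0, hk⟩) (by simp [h])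
    obtain ⟨A, hA, hAY⟩ := Polydomain.exists_isMultiAnalytic_comp_adjoint_eq hm (hpos m le_rfl hm0)
    exact ⟨Polydomain.PolyFock n H, inferInstance, inferInstance, inferInstance, A, hA, hAY.symm⟩
  · have hpos (p : Fin k → ℕ) (hp : p ≤ m) :=
      hT.isPositive_defect_starProjection hm (hp.trans fun i => (hm1 i).le)
    exact ⟨hpos, (Polydomain.isBeurlingType_iff hm M).2 hpos⟩
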